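/- Let $n\ge 0$, and let $\widetilde S_n$ be the affine symmetric group, i.e. the group (under composition) of bijections $w:\mathbb Z\to\mathbb Z$ with $w(i+n)=w(i)+n$ for all $i$ and $\sum_{i=1}^n w(i)=\binom{n+1}{2}$. It is generated, for $n\ge 2$, by $s_0,\dots,s_{n-1}$, where $s_i$ interchanges $i+kn$ and $i+1+kn$ for every $k\in\mathbb Z$ (there are no generators for $n=1$). Let $\ell(w)$ be the Coxeter length of $w$, the minimal number of factors in an expression of $w$ as a product of these generators; the expressions with $\ell(w)$ factors are called reduced. The element $w$ is fully commutative if any two of its reduced expressions are connected by a sequence of moves that interchange two adjacent commuting generators. The abacus of $w$ is the set of positions (beads) $\{\,w(i)-kn : 1\le i\le n,\ k\ge 0\,\}\subset\mathbb Z$; it depends only on the coset $wS_n$, where $S_n=\langle s_1,\dots,s_{n-1}\rangle$. The normalized abacus of $w$ is the translate of this set for which $n+1$ is the smallest position that is not a bead. Call $w$ long if the last (largest) bead of its normalized abacus is at a position $>2n$. Let $(q)_m=\prod_{i=1}^m(1-q^i)$ and $\binom{n}{k}_q=\frac{(q)_n}{(q)_k(q)_{n-k}}$. Then, for each $m\ge0$,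 there are only finitely many long fully commutative elements of length $m$ in $\widetilde S_n$, and, as formal power series in $q$, $$\sum_{\substack{w\in\widetilde S_n \text{ fully commutative}\\ w\text{ long}}} q^{\ell(w)}=\frac{q^n}{1-q^n}\sum_{k=1}^{n-1}\binom{n}{k}_q^{2}.$$ (For $n=0$ and $n=1$ there are no long elements, the sum on the right is empty, and both sides are read as $0$.) -/

import Mathlib

/-- The `n`-periodic functions on `ℤ` have the same sum over the window `1, …, n` before and after
composition with a bijection `w` of `ℤ` satisfying `w (i + n) = w i + n`. -/
theorem sum_window_comp (n : ℕ) (w : Equiv.Perm ℤ) (hw : ∀ i, w (i + n) = w i + n)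
    (f : ℤ → ℤ) (hf : ∀ i, f (i + n) = f i) :
    ∑ i ∈ Finset.Icc (1 : ℤ) n, f (w i) = ∑ i ∈ Finset.Icc (1 : ℤ) n, f i := by
  rcases Nat.eq_zero_or_pos n with rfl | hn
  · simp
  have hn' : (0 : ℤ) < n := by exact_mod_cast hn
  have hf' : ∀ (k i : ℤ), f (i + k * n) = f i := by
    intro k i
    have h : Function.Periodic f (n : ℤ) := hf
    simpa using h.int_mul k i
  have hw' : ∀ (k i : ℤ), w (i + k * n) = w i + k * n := by
    intro k i
    induction k using Int.induction_on with
    | zero => simp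
    | succ k ih =>
      have := hw (i + k * n)
      rw [ih] at this
      rw [show i + ((k : ℤ) + 1) * n = i + k * n + n by ring, this]; ring
    | pred k ih =>
      have := hw (i + (-(k : ℤ) - 1) * n)
      rw [show i + (-(k : ℤ) - 1) * n + n = i + -(k : ℤ) * n by ring, ih] at this
      linarith
  -- the representative of `m` modulo `n` in the window
  let r : ℤ → ℤ := fun m => (m - 1) % n + 1
  have hr : ∀ m, r m ∈ Finset.Icc (1 : ℤ) n := by
    intro m
    have h1 := Int.emod_nonneg (m - 1) hn'.ne'
    have h2 := Int.emod_lt_of_pos (m - 1) hn'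
    simp only [r, Finset.mem_Icc]; constructor <;> linarith
  have hrm : ∀ m, m = r m + ((m - 1) / n) * n := by
    intro m
    have := Int.emod_add_mul_ediv (m - 1) n
    simp only [r]; linarith
  have hinj : Set.InjOn (fun i => r (w i)) (Finset.Icc (1 : ℤ) n) := by
    intro a ha b hb hab
    simp only [Finset.coe_Icc, Set.mem_Icc] at ha hb
    simp only at hab
    have h1 := hrm (w a)
    have h2 := hrm (w b)
    have h3 : w a = w (b + ((w a - 1) / n - (w b - 1) / n) * n) := by
      rw [hw']; rw [hab] at h1; linarith
    have h4 := w.injective h3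
    generalize (w a - 1) / n - (w b - 1) / n = c at h4
    have h5 : c < 1 := by by_contra hc; nlinarith
    have h6 : -1 < c := by by_contra hc; nlinarith
    have : c = 0 := by omega
    simpa [this] using h4
  have himg : (Finset.Icc (1 : ℤ) n).image (fun i => r (w i)) = Finset.Icc (1 : ℤ) n := by
    apply Finset.eq_of_subset_of_card_le
    · intro x hx
      obtain ⟨i, _, rfl⟩ := Finset.mem_image.1 hx
      exact hr _
    · rw [Finset.card_image_of_injOn hinj]
  calc ∑ i ∈ Finset.Icc (1 : ℤ) n, f (w i)
      = ∑ i ∈ Finset.Icc (1 : ℤ) n, f (r (w i)) := by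
        refine Finset.sum_congr rfl fun i _ => ?_
        conv_lhs => rw [hrm (w i)]
        exact hf' _ _
    _ = ∑ i ∈ (Finset.Icc (1 : ℤ) n).image (fun i => r (w i)), f i :=
        (Finset.sum_image hinj).symm
    _ = _ := by rw [himg]

/-- The affine symmetric group `S̃ₙ`: the bijections `w` of `ℤ` with `w (i + n) = w i + n` for all
`i` and `w 1 + ⋯ + w n = 1 + ⋯ + n`. Its multiplication is composition,
`(u * v) i = u (v i)`. -/
def affineSymmetricGroup (n : ℕ) : Subgroup (Equiv.Perm ℤ) where
  carrier := {w | (∀ i, w (i + n) = w i + n) ∧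
    ∑ i ∈ Finset.Icc (1 : ℤ) n, w i = ∑ i ∈ Finset.Icc (1 : ℤ) n, i}
  one_mem' := by simp
  mul_mem' := by
    rintro u v ⟨hu, hu'⟩ ⟨hv, hv'⟩
    refine ⟨fun i => by simp [hu, hv], ?_⟩
    have h := sum_window_comp n v hv (fun j => u j - j) (fun i => by simp [hu])
    simp only [Finset.sum_sub_distrib] at h
    simp only [Equiv.Perm.mul_apply]
    linarith
  inv_mem' := by
    rintro v ⟨hv, hv'⟩
    have hi : ∀ i, v⁻¹ (i + n) = v⁻¹ i + n := by
      intro i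
      apply v.injective
      simp [hv]
    refine ⟨hi, ?_⟩
    have h := sum_window_comp n v hv (fun j => v⁻¹ j - j) (fun i => by simp [hi])
    have hvv : ∀ i, v⁻¹ (v i) = i := fun i => v.symm_apply_apply i
    simp only [Finset.sum_sub_distrib, hvv] at h
    linarith

/-- The Coxeter generators `s_i` of `S̃ₙ`: `s_i` interchanges `i + k n` and `i + 1 + k n` for all
`k ∈ ℤ`. (So `s_i` depends on `i` modulo `n` only; there are `n` generators if `n ≥ 2` and there is
none if `n = 1`, because the translation `m ↦ m + 1` does not belong to `S̃₁`.) -/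
def coxeterGenerators (n : ℕ) : Set (affineSymmetricGroup n) :=
  {s | ∃ i : ℤ, ∀ m : ℤ, (s : Equiv.Perm ℤ) m =
    if m ≡ i [ZMOD n] then m + 1 else if m ≡ i + 1 [ZMOD n] then m - 1 else m}

/-- `l` is an expression for `w`: a word in the Coxeter generators whose product is `w`. -/
def IsExpression {n : ℕ} (l : List (affineSymmetricGroup n)) (w : affineSymmetricGroup n) : Prop :=
  (∀ s ∈ l, s ∈ coxeterGenerators n) ∧ l.prod = w

/-- The Coxeter length of `w`: the minimal number of factors of an expression for `w`. -/
noncomputable def coxeterLength {n : ℕ} (w : affineSymmetricGroup n) : ℕ :=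
  sInf {k | ∃ l, IsExpression l w ∧ l.length = k}

/-- The reduced expressions for `w`: those with the minimal number of factors. -/
def IsReducedExpression {n : ℕ} (l : List (affineSymmetricGroup n))
    (w : affineSymmetricGroup n) : Prop :=
  IsExpression l w ∧ ∀ l', IsExpression l' w → l.length ≤ l'.length

/-- A commuting move: two adjacent commuting factors of a word are interchanged. -/
def CommutingMove {n : ℕ} (l l' : List (affineSymmetricGroup n)) : Prop :=
  ∃ (a b : List (affineSymmetricGroup n)) (s t : affineSymmetricGroup n),
    s * t = t * s ∧ l = a ++ s :: t :: b ∧ l' = a ++ t :: s :: b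

/-- `w` is fully commutative: its reduced expressions form a single commutativity class, that is,
any two of them are connected by a sequence of commuting moves. -/
def IsFullyCommutative {n : ℕ} (w : affineSymmetricGroup n) : Prop :=
  ∀ l l', IsReducedExpression l w → IsReducedExpression l' w →
    Relation.ReflTransGen CommutingMove l l'

/-- The beads of the (balanced) abacus of `w`: on the runner (residue class modulo `n`) of each
entry `w i`, `1 ≤ i ≤ n`, of the base window, all positions up to and including `w i` carry a bead.
Only the set of entries of the base window matters, so `w` has the same abacus as
the minimal length representative of the coset `w Sₙ`, whose base window lists these entries
increasingly. -/
def abacus {n : ℕ} (w : affineSymmetricGroup n) : Set ℤ :=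
  {p | ∃ i ∈ Finset.Icc (1 : ℤ) n, ∃ k : ℕ, p = (w : Equiv.Perm ℤ) i - k * n}

/-- `A` is the normalized abacus of `w`: the translate of the abacus of `w` whose first gap in
reading order is at position `n + 1`. -/
def IsNormalizedAbacus {n : ℕ} (w : affineSymmetricGroup n) (A : Set ℤ) : Prop :=
  (∃ d : ℤ, A = (fun p => p + d) '' abacus w) ∧ IsLeast Aᶜ ((n : ℤ) + 1)

/-- `w` is long: the last bead of its normalized abacus occurs at a position `> 2 n`. -/
def IsLong {n : ℕ} (w : affineSymmetricGroup n) : Prop :=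
  ∃ (A : Set ℤ) (i : ℤ), IsNormalizedAbacus w A ∧ IsGreatest A i ∧ 2 * (n : ℤ) < i

/-- The set of long fully commutative elements of `S̃ₙ` of Coxeter length `m`. -/
def longFullyCommutative (n m : ℕ) : Set (affineSymmetricGroup n) :=
  {w | IsFullyCommutative w ∧ IsLong w ∧ coxeterLength w = m}

/-- `(q)_n = (1 - q) (1 - q²) ⋯ (1 - qⁿ)`, as a formal power series in `q = X`. -/
noncomputable def qPochhammer (n : ℕ) : PowerSeries ℚ :=
  ∏ i ∈ Finset.range n, (1 - PowerSeries.X ^ (i + 1))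

/-- The `q`-binomial coefficient `(q)_n / ((q)_k (q)_{n-k})` for `k ≤ n`. The denominator has
constant term `1`, so the inverse is a true inverse in the ring of formal power series. -/
noncomputable def qBinomial (n k : ℕ) : PowerSeries ℚ :=
  qPochhammer n * (qPochhammer k * qPochhammer (n - k))⁻¹

/-! The length of `w` is its number of inversions modulo translation by `n` (`coxeterLength_eq`),
and `w` is fully commutative exactly when no three positions carry decreasing values
(`isFullyCommutative_iff`).

Let `s` and `t` be the positions of the largest and smallest window entries; `w` is long when these
entries differ by at least `2n`. Then `s - n` carries a large value left of the window and `t + n` a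
small value right of it. Avoiding 321 therefore splits the positions into high and low ones, unions
of residue classes on each of which `w` increases (`exists_data`). Such an element is determined by
the set `A` of high positions, the set `H` of residues of their values, and a shift `c` between the
two enumerations; the window sum fixes the shift on the low class. With `k = |A| = |H|`, the
residues in `H` are those of the values raised by `k`: under this convention longness means `c > k`,
whatever `A` and `H` are.

Every high position moves right and every low one left. So a high position `i` starts `w i - i`
inversions and a low one none, and the length is `ΣH - ΣA + nc - k²`. In terms of the complement
`Aᶜ` this is `n(c - k) + ΣH + ΣAᶜ - C(k,2) - C(n-k,2)`. Summing over `c > k` gives `qⁿ/(1 - qⁿ)`;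
summing over `H` and over `Aᶜ` gives one `q`-binomial each (`sum_powersetCard`). -/

namespace AffinePerm

variable {n : ℕ}

/-! ### Periodicity and the Coxeter generators -/

theorem apply_add (w : affineSymmetricGroup n) (i : ℤ) : w.1 (i + n) = w.1 i + n := w.2.1 i

theorem apply_add_mul (w : affineSymmetricGroup n) (i q : ℤ) :
    w.1 (i + q * n) = w.1 i + q * n := by
  induction q using Int.induction_on with
  | zero => simp
  | succ q ih =>
    rw [show i + ((q : ℤ) + 1) * n = i + q * n + n by ring, apply_add, ih]; ring
  | pred q ih =>
    have := apply_add w (i + (-(q : ℤ) - 1) * n)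
    rw [show i + (-(q : ℤ) - 1) * n + n = i + -(q : ℤ) * n by ring, ih] at this
    linarith

theorem exists_window (hn : 0 < n) (x : ℤ) :
    ∃ i ∈ Finset.Icc (1 : ℤ) n, ∃ q : ℤ, x = i + q * n := by
  have hn' : (0 : ℤ) < n := by exact_mod_cast hn
  refine ⟨(x - 1) % n + 1, ?_, (x - 1) / n, ?_⟩
  · have h1 := Int.emod_nonneg (x - 1) hn'.ne'
    have h2 := Int.emod_lt_of_pos (x - 1) hn'
    rw [Finset.mem_Icc]; constructor <;> linarith
  · have := Int.emod_add_mul_ediv (x - 1) n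
    linarith

theorem window_unique {i j q : ℤ} (hi : i ∈ Finset.Icc (1 : ℤ) n) (hj : j ∈ Finset.Icc (1 : ℤ) n)
    (h : i = j + q * n) : q = 0 := by
  rw [Finset.mem_Icc] at hi hj
  have h1 : q < 1 := by by_contra hc; nlinarith
  have h2 : -1 < q := by by_contra hc; nlinarith
  omega

theorem sum_window_indicator (hn : 0 < n) (p : ℤ) :
    ∑ i ∈ Finset.Icc (1 : ℤ) n, (if i ≡ p [ZMOD n] then (1 : ℤ) else 0) = 1 := by
  obtain ⟨j, hj, q, rfl⟩ := exists_window hn p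
  rw [Finset.sum_eq_single j]
  · rw [if_pos]
    exact (Int.modEq_iff_dvd.2 ⟨q, by ring⟩)
  · intro i hi hij
    rw [if_neg]
    intro h
    obtain ⟨c, hc⟩ := Int.modEq_iff_dvd.1 h
    have : q - c = 0 := window_unique hi hj (q := q - c) (by linarith)
    apply hij
    have : q = c := by omega
    subst this
    linarith
  · exact fun h => absurd hj h

/-- The underlying function of the generator `s_p`. -/
def reflectionFun (n : ℕ) (p m : ℤ) : ℤ :=
  if m ≡ p [ZMOD n] then m + 1 else if m ≡ p + 1 [ZMOD n] then m - 1 else m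

theorem not_modEq_succ (hn : 2 ≤ n) (p : ℤ) : ¬ p + 1 ≡ p [ZMOD n] := by
  intro h
  have := (Int.modEq_iff_dvd.1 h)
  have h2 : (n : ℤ) ∣ 1 := by
    have := (dvd_neg.2 this); simpa using this
  have := Int.le_of_dvd one_pos h2
  omega

theorem reflectionFun_left {p m : ℤ} (h : m ≡ p [ZMOD n]) : reflectionFun n p m = m + 1 := if_pos h

theorem reflectionFun_right (hn : 2 ≤ n) {p m : ℤ} (h : m ≡ p + 1 [ZMOD n]) :
    reflectionFun n p m = m - 1 := by
  rw [reflectionFun, if_neg, if_pos h]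
  exact fun h' => not_modEq_succ hn p (h.symm.trans h')

theorem reflectionFun_other {p m : ℤ} (h : ¬ m ≡ p [ZMOD n]) (h' : ¬ m ≡ p + 1 [ZMOD n]) :
    reflectionFun n p m = m := by
  rw [reflectionFun, if_neg h, if_neg h']

theorem reflectionFun_involutive (hn : 2 ≤ n) (p : ℤ) :
    Function.Involutive (reflectionFun n p) := by
  intro m
  by_cases h : m ≡ p [ZMOD n]
  · rw [reflectionFun_left h, reflectionFun_right hn (h.add_right 1)]; ring
  by_cases h' : m ≡ p + 1 [ZMOD n]
  · rw [reflectionFun_right hn h', reflectionFun_left]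
    · ring
    · simpa using h'.sub_right 1
  rw [reflectionFun_other h h', reflectionFun_other h h']

theorem reflectionFun_add (p m : ℤ) : reflectionFun n p (m + n) = reflectionFun n p m + n := by
  have h : ∀ a : ℤ, (m + n ≡ a [ZMOD n]) ↔ (m ≡ a [ZMOD n]) := fun a => by simp [Int.ModEq]
  simp only [reflectionFun, h]
  split_ifs <;> ring

/-- The generator `s_p`, for `n ≥ 2`. -/
def simpleReflection (hn : 2 ≤ n) (p : ℤ) : affineSymmetricGroup n :=
  ⟨(reflectionFun_involutive hn p).toPerm _, by
    refine ⟨fun i => reflectionFun_add p i, ?_⟩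
    have h : ∀ i : ℤ, (reflectionFun_involutive hn p).toPerm _ i =
        i + (if i ≡ p [ZMOD n] then (1 : ℤ) else 0) - (if i ≡ p + 1 [ZMOD n] then (1 : ℤ) else 0) := by
      intro i
      have h3 : i ≡ p [ZMOD n] → ¬ i ≡ p + 1 [ZMOD n] := fun h h' =>
        not_modEq_succ hn p (h'.symm.trans h)
      rw [Function.Involutive.coe_toPerm, reflectionFun]
      split_ifs <;> simp_all
    simp only [h, Finset.sum_sub_distrib, Finset.sum_add_distrib,
      sum_window_indicator (show 0 < n by omega)]
    ring⟩

theorem simpleReflection_apply (hn : 2 ≤ n) (p m : ℤ) :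
    (simpleReflection hn p).1 m = reflectionFun n p m := rfl

theorem simpleReflection_mem (hn : 2 ≤ n) (p : ℤ) : simpleReflection hn p ∈ coxeterGenerators n :=
  ⟨p, fun _ => rfl⟩

theorem mem_coxeterGenerators (hn : 2 ≤ n) {s : affineSymmetricGroup n} :
    s ∈ coxeterGenerators n ↔ ∃ p, s = simpleReflection hn p := by
  constructor
  · rintro ⟨p, hp⟩
    exact ⟨p, Subtype.ext (Equiv.ext hp)⟩
  · rintro ⟨p, rfl⟩
    exact simpleReflection_mem hn p

theorem simpleReflection_mul_self (hn : 2 ≤ n) (p : ℤ) :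
    simpleReflection hn p * simpleReflection hn p = 1 :=
  Subtype.ext (Equiv.ext fun m => reflectionFun_involutive hn p m)

theorem mul_simpleReflection_apply (hn : 2 ≤ n) (w : affineSymmetricGroup n) (p m : ℤ) :
    (w * simpleReflection hn p).1 m = w.1 (reflectionFun n p m) := rfl

theorem mul_simpleReflection_cancel (hn : 2 ≤ n) (w : affineSymmetricGroup n) (p : ℤ) :
    w * simpleReflection hn p * simpleReflection hn p = w := by
  rw [mul_assoc, simpleReflection_mul_self, mul_one]

theorem simpleReflection_congr (hn : 2 ≤ n) {p q : ℤ} (h : p ≡ q [ZMOD n]) :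
    simpleReflection hn p = simpleReflection hn q := by
  refine Subtype.ext (Equiv.ext fun m => ?_)
  rw [simpleReflection_apply, simpleReflection_apply, reflectionFun, reflectionFun]
  have h1 : (m ≡ p [ZMOD n]) ↔ (m ≡ q [ZMOD n]) := ⟨fun h' => h'.trans h, fun h' => h'.trans h.symm⟩
  have h2 : (m ≡ p + 1 [ZMOD n]) ↔ (m ≡ q + 1 [ZMOD n]) :=
    ⟨fun h' => h'.trans (h.add_right 1), fun h' => h'.trans (h.add_right 1).symm⟩
  simp only [h1, h2]

/-- A simple reflection keeps the order of all pairs of positions but those which it swaps. -/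
theorem reflectionFun_lt (hn : 2 ≤ n) {p a b : ℤ} (hab : a < b)
    (h : ¬ (a ≡ p [ZMOD n] ∧ b = a + 1)) : reflectionFun n p a < reflectionFun n p b := by
  have hne : reflectionFun n p a ≠ reflectionFun n p b := fun h' =>
    hab.ne ((reflectionFun_involutive hn p).injective h')
  have key : b ≡ p + 1 [ZMOD n] → b = a + 1 → a ≡ p [ZMOD n] := by
    rintro h1 rfl
    simpa using h1.sub_right 1
  refine lt_of_le_of_ne ?_ hne
  simp only [reflectionFun] at hne ⊢
  split_ifs at hne ⊢ <;> first | omega | (by_cases hb : b = a + 1 <;> simp_all; omega)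

/-! ### Coxeter length as number of inversions -/

theorem exists_bound (hn : 0 < n) (w : affineSymmetricGroup n) : ∃ M : ℤ, ∀ j, j - M ≤ w.1 j := by
  obtain ⟨i, -, hi⟩ := Finset.exists_min_image (Finset.Icc (1 : ℤ) n) (fun j => w.1 j - j)
    ⟨1, by simp; omega⟩
  refine ⟨-(w.1 i - i), fun j => ?_⟩
  obtain ⟨a, ha, q, rfl⟩ := exists_window hn j
  have := hi a ha
  rw [apply_add_mul]
  linarith

/-- Finiteness matters because `ncard` is `0` on infinite sets. -/
theorem inversions_finite (hn : 0 < n) (w : affineSymmetricGroup n) (i c : ℤ) :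
    {j | i < j ∧ w.1 j < c}.Finite := by
  obtain ⟨M, hM⟩ := exists_bound hn w
  refine (Set.finite_Icc i (c + M)).subset ?_
  rintro j ⟨h1, h2⟩
  have := hM j
  exact ⟨h1.le, by linarith⟩

/-- The number of inversions of `w` whose left position is `i`. -/
noncomputable def inversionCount (w : affineSymmetricGroup n) (i : ℤ) : ℤ :=
  ({j | i < j ∧ w.1 j < w.1 i}.ncard : ℤ)

theorem inversionCount_nonneg (w : affineSymmetricGroup n) (i : ℤ) : 0 ≤ inversionCount w i :=
  Int.natCast_nonneg _

theorem inversionCount_add (w : affineSymmetricGroup n) (i : ℤ) :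
    inversionCount w (i + n) = inversionCount w i := by
  rw [inversionCount, inversionCount]
  congr 1
  refine Set.ncard_congr (fun j _ => j - n) ?_ ?_ ?_
  · rintro j ⟨h1, h2⟩
    have := apply_add w (j - n)
    rw [apply_add] at h2
    rw [sub_add_cancel] at this
    exact ⟨by linarith, by linarith⟩
  · intro a b _ _ h
    linarith
  · rintro j ⟨h1, h2⟩
    exact ⟨j + n, ⟨by linarith, by rw [apply_add, apply_add]; linarith⟩, by ring⟩

theorem inversionCount_eq_zero {w : affineSymmetricGroup n} {i : ℤ}
    (h : ∀ j, i < j → w.1 i < w.1 j) : inversionCount w i = 0 := by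
  rw [inversionCount]
  have : {j | i < j ∧ w.1 j < w.1 i} = ∅ := by
    ext j
    simp only [Set.mem_ofPred_eq, Set.mem_empty_iff_false, iff_false, not_and, not_lt]
    exact fun hj => (h j hj).le
  simp [this]

/-- The number of inversions of `w` modulo simultaneous translation by `n`. -/
noncomputable def inversionNumber (w : affineSymmetricGroup n) : ℤ :=
  ∑ i ∈ Finset.Icc (1 : ℤ) n, inversionCount w i

theorem inversionNumber_nonneg (w : affineSymmetricGroup n) : 0 ≤ inversionNumber w :=
  Finset.sum_nonneg fun i _ => inversionCount_nonneg w i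

theorem modEq_apply_lt {w : affineSymmetricGroup n} {p i c : ℤ} (hi : i ≡ p [ZMOD n])
    (h : w.1 p < w.1 (p + c)) : w.1 i < w.1 (i + c) := by
  obtain ⟨q, hq⟩ := Int.modEq_iff_dvd.1 hi
  have e : i = p + (-q) * n := by linarith
  rw [e, show p + -q * n + c = (p + c) + (-q) * n by ring, apply_add_mul, apply_add_mul]
  linarith

theorem modEq_apply_gt {w : affineSymmetricGroup n} {p i c : ℤ} (hi : i ≡ p [ZMOD n])
    (h : w.1 (p + c) < w.1 p) : w.1 (i + c) < w.1 i := by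
  obtain ⟨q, hq⟩ := Int.modEq_iff_dvd.1 hi
  have e : i = p + (-q) * n := by linarith
  rw [e, show p + -q * n + c = (p + c) + (-q) * n by ring, apply_add_mul, apply_add_mul]
  linarith

/-- The reflection matches the inversions of `w` with those of the product, except that each swapped
pair becomes a new inversion starting at a position congruent to `p`. -/
theorem inversionCount_mul (hn : 2 ≤ n) (w : affineSymmetricGroup n) {p : ℤ}
    (h : w.1 p < w.1 (p + 1)) (i : ℤ) :
    inversionCount (w * simpleReflection hn p) i =
      inversionCount w (reflectionFun n p i) + if i ≡ p [ZMOD n] then 1 else 0 := by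
  set r := reflectionFun n p with hr
  have hinv : ∀ m, r (r m) = m := reflectionFun_involutive hn p
  have himg : {j | i < j ∧ (w * simpleReflection hn p).1 j < (w * simpleReflection hn p).1 i} =
      r ⁻¹' {j | i < r j ∧ w.1 j < w.1 (r i)} := by
    ext j
    simp only [Set.mem_ofPred_eq, Set.mem_preimage, hinv, mul_simpleReflection_apply, ← hr]
  rw [inversionCount, himg, Set.ncard_preimage_of_injective_subset_range
    (reflectionFun_involutive hn p).injective
    (by rw [(reflectionFun_involutive hn p).surjective.range_eq]; exact Set.subset_univ _)]
  by_cases hi : i ≡ p [ZMOD n]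
  · have hlt := modEq_apply_lt hi h
    have hri : r i = i + 1 := reflectionFun_left hi
    have hri' : r (i + 1) = i := by rw [← hri, hinv]
    -- The extra element `i` is the partner in the swapped pair: `r i = i + 1` and `w i < w (i +
    -- 1)`.
    have hset : {j | i < r j ∧ w.1 j < w.1 (r i)} =
        insert i {j | i + 1 < j ∧ w.1 j < w.1 (i + 1)} := by
      ext j
      simp only [Set.mem_ofPred_eq, Set.mem_insert_iff, hri]
      rcases lt_trichotomy j i with hj | rfl | hj
      · have := reflectionFun_lt hn hj (p := p)
          (fun hc => not_modEq_succ hn p (by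
            have := hc.1.add_right 1
            rw [← hc.2] at this
            exact this.symm.trans hi))
        rw [← hr, hri] at this
        constructor
        · rintro ⟨h1, -⟩
          omega
        · rintro (h1 | ⟨h1, -⟩) <;> omega
      · simp [hri, hlt]
      · by_cases hj1 : j = i + 1
        · subst hj1
          simp [hri']
        · have := reflectionFun_lt hn hj (p := p) (fun hc => hj1 hc.2)
          rw [← hr, hri] at this
          have h2 : i + 1 < j := by omega
          have h3 : i < r j := by omega
          simp [h2, h3, hj.ne']
    rw [hset, Set.ncard_insert_of_notMem (by simp) (inversions_finite (by omega) w _ _), hri, if_pos hi,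
      inversionCount]
    push_cast; rfl
  · rw [if_neg hi, add_zero, inversionCount]
    congr 2
    ext j
    simp only [Set.mem_ofPred_eq]
    by_cases hi' : i ≡ p + 1 [ZMOD n]
    -- The two sets could differ only at `j = i`, which lies in neither because `w (i - 1) < w i`.
    · have hri : r i = i - 1 := reflectionFun_right hn hi'
      have hip : i - 1 ≡ p [ZMOD n] := by simpa using hi'.sub_right 1
      have hlt := modEq_apply_lt hip h
      have hri' : r (i - 1) = i := by rw [← hri, hinv]
      rw [sub_add_cancel] at hlt
      rw [hri]
      rcases lt_trichotomy j i with hj | rfl | hj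
      · by_cases hj1 : j = i - 1
        · subst hj1; simp
        · have h3 : r j < i := by
            have := reflectionFun_lt hn hj (p := p) (fun hc => hj1 (by omega))
            rw [← hr, hri] at this
            omega
          constructor
          · rintro ⟨h1, -⟩
            omega
          · rintro ⟨h1, -⟩
            omega
      · simp only [hri]
        constructor
        · rintro ⟨h1, -⟩
          omega
        · rintro ⟨-, h1⟩
          omega
      · have h1 := reflectionFun_lt hn hj (p := p) (fun hc => hi hc.1)
        have h2 := reflectionFun_lt hn (show i - 1 < j by omega) (p := p) (fun hc => by omega)
        rw [← hr, hri'] at h2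
        simp [h2, show i - 1 < j by omega]
    · have hri : r i = i := reflectionFun_other hi hi'
      rw [hri]
      suffices h : i < r j ↔ i < j by rw [h]
      constructor
      · intro hj
        have := reflectionFun_lt hn hj (p := p) (fun hc => hi hc.1)
        rwa [← hr, hri, hinv] at this
      · intro hj
        have := reflectionFun_lt hn hj (p := p) (fun hc => hi hc.1)
        rwa [← hr, hri] at this

theorem inversionNumber_mul_of_lt (hn : 2 ≤ n) (w : affineSymmetricGroup n) {p : ℤ}
    (h : w.1 p < w.1 (p + 1)) :
    inversionNumber (w * simpleReflection hn p) = inversionNumber w + 1 := by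
  rw [inversionNumber, Finset.sum_congr rfl fun i _ => inversionCount_mul hn w h i,
    Finset.sum_add_distrib, sum_window_indicator (by omega)]
  congr 1
  exact sum_window_comp n (simpleReflection hn p).1 (simpleReflection hn p).2.1
    (inversionCount w) (inversionCount_add w)

theorem reflectionFun_self (p : ℤ) : reflectionFun n p p = p + 1 :=
  reflectionFun_left (Int.ModEq.refl p)

theorem reflectionFun_succ (hn : 2 ≤ n) (p : ℤ) : reflectionFun n p (p + 1) = p := by
  rw [reflectionFun_right hn (Int.ModEq.refl _)]; ring

theorem inversionNumber_mul_of_gt (hn : 2 ≤ n) (w : affineSymmetricGroup n) {p : ℤ}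
    (h : w.1 (p + 1) < w.1 p) :
    inversionNumber (w * simpleReflection hn p) = inversionNumber w - 1 := by
  have := inversionNumber_mul_of_lt hn (w * simpleReflection hn p) (p := p) (by
    rwa [mul_simpleReflection_apply, mul_simpleReflection_apply, reflectionFun_self,
      reflectionFun_succ hn])
  rw [mul_simpleReflection_cancel] at this
  linarith

/-- Surjectivity leaves no room for a jump larger than one. The lemma is used both to find descents
and to compare two enumerations of one set. -/
theorem strictMono_surjective_int {f : ℤ → ℤ} (hf : StrictMono f) (hs : Function.Surjective f) (i : ℤ) :
    f i = i + f 0 := by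
  have h : ∀ i, f (i + 1) = f i + 1 := by
    intro i
    obtain ⟨j, hj⟩ := hs (f i + 1)
    have h1 : i < j := hf.lt_iff_lt.1 (by omega)
    have h2 : f (i + 1) ≤ f j := hf.monotone (by omega)
    have h3 := hf (show i < i + 1 by omega)
    omega
  induction i using Int.induction_on with
  | zero => simp
  | succ i ih => rw [h, ih]; ring
  | pred i ih =>
    have := h (-(i : ℤ) - 1)
    rw [sub_add_cancel, ih] at this
    linarith

/-- Without descents `w` is a translation, and the window sum forces the translation to be zero. -/
theorem exists_descent (hn : 2 ≤ n) {w : affineSymmetricGroup n} (hw : w ≠ 1) :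
    ∃ p, w.1 (p + 1) < w.1 p := by
  by_contra! hc
  apply hw
  have hmono : StrictMono w.1 := strictMono_int_of_lt_succ fun i =>
    lt_of_le_of_ne (hc i) fun h => by have := w.1.injective h; omega
  have h := strictMono_surjective_int hmono w.1.surjective
  have hsum := w.2.2
  rw [Finset.sum_congr rfl fun i _ => h i, Finset.sum_add_distrib] at hsum
  have h0 : w.1 0 = 0 := by
    simp at hsum
    omega
  refine Subtype.ext (Equiv.ext fun i => ?_)
  rw [h i, h0]
  simp

theorem inversionNumber_one : inversionNumber (1 : affineSymmetricGroup n) = 0 :=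
  Finset.sum_eq_zero fun _ _ => inversionCount_eq_zero fun _ hj => hj

theorem inversionNumber_le_length (hn : 2 ≤ n) (l : List (affineSymmetricGroup n)) :
    ∀ w, IsExpression l w → inversionNumber w ≤ l.length := by
  induction l using List.reverseRecOn with
  | nil =>
    rintro w ⟨-, rfl⟩
    simp [inversionNumber_one]
  | append_singleton l s ih =>
    rintro w ⟨h1, rfl⟩
    obtain ⟨p, rfl⟩ := (mem_coxeterGenerators hn).1 (h1 s (by simp))
    have := ih l.prod ⟨fun s hs => h1 s (by simp [hs]), rfl⟩
    rw [List.prod_append, List.prod_singleton, List.length_append, List.length_singleton]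
    push_cast
    rcases lt_or_ge (l.prod.1 p) (l.prod.1 (p + 1)) with h | h
    · rw [inversionNumber_mul_of_lt hn _ h]; linarith
    · rw [inversionNumber_mul_of_gt hn _ (lt_of_le_of_ne h fun h => by
        have := l.prod.1.injective h; omega)]
      linarith

theorem isExpression_append {l l' : List (affineSymmetricGroup n)} {w w' : affineSymmetricGroup n}
    (h : IsExpression l w) (h' : IsExpression l' w') : IsExpression (l ++ l') (w * w') := by
  refine ⟨fun s hs => ?_, by rw [List.prod_append, h.2, h'.2]⟩
  rcases List.mem_append.1 hs with hs | hs
  exacts [h.1 s hs, h'.1 s hs]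

theorem isExpression_singleton (hn : 2 ≤ n) (p : ℤ) :
    IsExpression [simpleReflection hn p] (simpleReflection hn p) :=
  ⟨by simpa using simpleReflection_mem hn p, by simp⟩

theorem exists_expression (hn : 2 ≤ n) (k : ℕ) (w : affineSymmetricGroup n)
    (hk : inversionNumber w = k) : ∃ l, IsExpression l w ∧ l.length = k := by
  induction k generalizing w with
  | zero =>
    by_cases hw : w = 1
    · exact ⟨[], ⟨by simp, by simp [hw]⟩, rfl⟩
    · obtain ⟨p, hp⟩ := exists_descent hn hw
      have := inversionNumber_mul_of_gt hn w hp
      have h2 := inversionNumber_nonneg (w * simpleReflection hn p)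
      push_cast at hk
      omega
  | succ k ih =>
    have hw : w ≠ 1 := by
      rintro rfl
      rw [inversionNumber_one] at hk
      push_cast at hk
      omega
    obtain ⟨p, hp⟩ := exists_descent hn hw
    have := inversionNumber_mul_of_gt hn w hp
    obtain ⟨l, hl, hlk⟩ := ih (w * simpleReflection hn p) (by push_cast at hk; omega)
    refine ⟨l ++ [simpleReflection hn p], ?_, by simp [hlk]⟩
    have := isExpression_append hl (isExpression_singleton hn p)
    rwa [mul_simpleReflection_cancel] at this

/-- Each letter changes the inversion number by one, which bounds the length from below; removing
descents until none is left attains the bound. -/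
theorem coxeterLength_eq (hn : 2 ≤ n) (w : affineSymmetricGroup n) :
    (coxeterLength w : ℤ) = inversionNumber w := by
  obtain ⟨k, hk⟩ := Int.eq_ofNat_of_zero_le (inversionNumber_nonneg w)
  have hmem := exists_expression hn k w hk
  have h1 : coxeterLength w ≤ k := Nat.sInf_le hmem
  obtain ⟨l, hl, hlk⟩ := Nat.sInf_mem (s := {k | ∃ l, IsExpression l w ∧ l.length = k}) ⟨k, hmem⟩
  have h2 := inversionNumber_le_length hn l w hl
  have h3 : l.length = coxeterLength w := hlk
  omega

theorem isReducedExpression_iff (hn : 2 ≤ n) {l : List (affineSymmetricGroup n)}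
    {w : affineSymmetricGroup n} :
    IsReducedExpression l w ↔ IsExpression l w ∧ (l.length : ℤ) = inversionNumber w := by
  constructor
  · rintro ⟨h1, h2⟩
    obtain ⟨k, hk⟩ := Int.eq_ofNat_of_zero_le (inversionNumber_nonneg w)
    obtain ⟨l', hl', hlk⟩ := exists_expression hn k w hk
    have := h2 l' hl'
    have := inversionNumber_le_length hn l w h1
    exact ⟨h1, by omega⟩
  · rintro ⟨h1, h2⟩
    refine ⟨h1, fun l' hl' => ?_⟩
    have := inversionNumber_le_length hn l' w hl'
    omega

/-- A position with no larger value to its left starts as many inversions as the distance by which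
it is moved to the right. -/
theorem inversionCount_eq_sub (hn : 2 ≤ n) (k : ℕ) (w : affineSymmetricGroup n)
    (hk : inversionNumber w = k) (i : ℤ) (hi : ∀ j, j < i → w.1 j < w.1 i) :
    inversionCount w i = w.1 i - i := by
  induction k generalizing w i with
  | zero =>
    have : w = 1 := by
      by_contra hw
      obtain ⟨p, hp⟩ := exists_descent hn hw
      have := inversionNumber_mul_of_gt hn w hp
      have h2 := inversionNumber_nonneg (w * simpleReflection hn p)
      push_cast at hk
      omega
    subst this
    rw [inversionCount_eq_zero fun _ hj => hj]
    simp
  | succ k ih =>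
    have hw : w ≠ 1 := by
      rintro rfl
      rw [inversionNumber_one] at hk
      push_cast at hk
      omega
    obtain ⟨p, hp⟩ := exists_descent hn hw
    have hv := inversionNumber_mul_of_gt hn w hp
    set v := w * simpleReflection hn p with hvdef
    have hwv : w = v * simpleReflection hn p := by rw [hvdef, mul_simpleReflection_cancel]
    have hvp : v.1 p < v.1 (p + 1) := by
      rwa [hvdef, mul_simpleReflection_apply, mul_simpleReflection_apply, reflectionFun_self,
        reflectionFun_succ hn]
    have hinv : ∀ m, reflectionFun n p (reflectionFun n p m) = m := reflectionFun_involutive hn p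
    have hvr : ∀ m, v.1 (reflectionFun n p m) = w.1 m := fun m => by
      rw [hvdef, mul_simpleReflection_apply, hinv]
    -- Otherwise `i - 1` would be the upper half of a descent, a larger value to the left of `i`.
    have hi1 : ¬ i ≡ p + 1 [ZMOD n] := by
      intro h
      have h3 : i - 1 ≡ p [ZMOD n] := by simpa using h.sub_right 1
      have h1 := modEq_apply_gt h3 hp
      have h2 := hi (i - 1) (by omega)
      rw [sub_add_cancel] at h1
      omega
    have hcount : inversionCount w i =
        inversionCount v (reflectionFun n p i) + if i ≡ p [ZMOD n] then 1 else 0 := by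
      conv_lhs => rw [hwv]
      exact inversionCount_mul hn v hvp i
    have hrec := ih v (by push_cast at hk; omega) (reflectionFun n p i) (by
      intro j hj
      rw [hvr]
      rw [← hinv j, hvr]
      -- If the reflection reverses this pair, then `j = i`, and the value that comes to stand left
      -- of `w i` is `w (i + 1)`, which is smaller by the descent.
      by_cases hex : j ≡ p [ZMOD n] ∧ reflectionFun n p i = j + 1
      · rw [reflectionFun_left hex.1, ← hex.2]
        have h3 : i ≡ p [ZMOD n] := by
          have := reflectionFun_left hex.1
          rw [← hex.2] at this
          have := (reflectionFun_involutive hn p).injective this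
          rw [← this]; exact hex.1
        rw [reflectionFun_left h3]
        exact modEq_apply_gt h3 hp
      · have := reflectionFun_lt hn hj hex
        rw [hinv] at this
        exact hi _ this)
    rw [hcount, hrec, hvr]
    split_ifs with h
    · rw [reflectionFun_left h]; ring
    · rw [reflectionFun_other h hi1]; ring

/-! ### Full commutativity and 321-avoidance -/

/-- `w` has no three positions `i < j < k` with `w i > w j > w k`. -/
def Avoids321 (w : affineSymmetricGroup n) : Prop :=
  ∀ i j k : ℤ, i < j → j < k → w.1 j < w.1 i → ¬ w.1 k < w.1 j

theorem apply_lt_of_modEq {w : affineSymmetricGroup n} {i j : ℤ} (h : i ≡ j [ZMOD n])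
    (hij : i < j) : w.1 i < w.1 j := by
  obtain ⟨q, hq⟩ := Int.modEq_iff_dvd.1 h
  have e : j = i + q * n := by linarith
  rw [e, apply_add_mul]
  linarith

/-- The reflection carries inversions of the product to inversions of `w`, hence a 321 to a 321. -/
theorem Avoids321_mul (hn : 2 ≤ n) {w : affineSymmetricGroup n} (hw : Avoids321 w) {p : ℤ}
    (hp : w.1 (p + 1) < w.1 p) : Avoids321 (w * simpleReflection hn p) := by
  have key : ∀ i j, i < j → (w * simpleReflection hn p).1 j < (w * simpleReflection hn p).1 i →
      reflectionFun n p i < reflectionFun n p j := by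
    intro i j hij h
    refine reflectionFun_lt hn hij ?_
    rintro ⟨h1, rfl⟩
    rw [mul_simpleReflection_apply, mul_simpleReflection_apply, reflectionFun_left h1,
      reflectionFun_right hn (h1.add_right 1), add_sub_cancel_right] at h
    exact absurd (modEq_apply_gt h1 hp) h.not_gt
  intro i j k hij hjk h1 h2
  exact hw _ _ _ (key i j hij h1) (key j k hjk h2) h1 h2

theorem isReducedExpression_concat (hn : 2 ≤ n) {m : List (affineSymmetricGroup n)}
    {s w : affineSymmetricGroup n} (h : IsReducedExpression (m ++ [s]) w) :
    ∃ p, s = simpleReflection hn p ∧ w.1 (p + 1) < w.1 p ∧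
      IsReducedExpression m (w * simpleReflection hn p) := by
  rw [isReducedExpression_iff hn] at h
  obtain ⟨⟨h1, h2⟩, h3⟩ := h
  obtain ⟨p, rfl⟩ := (mem_coxeterGenerators hn).1 (h1 s (by simp))
  have hm : IsExpression m (w * simpleReflection hn p) := by
    refine ⟨fun s hs => h1 s (by simp [hs]), ?_⟩
    rw [← h2, List.prod_append, List.prod_singleton, mul_simpleReflection_cancel]
  have hle := inversionNumber_le_length hn m _ hm
  rw [List.length_append, List.length_singleton] at h3
  push_cast at h3
  have hp : w.1 (p + 1) < w.1 p := by
    by_contra hc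
    have := inversionNumber_mul_of_lt hn w (p := p) (lt_of_le_of_ne (not_lt.1 hc) fun h => by
        have := w.1.injective h; omega)
    omega
  have := inversionNumber_mul_of_gt hn w hp
  exact ⟨p, rfl, hp, (isReducedExpression_iff hn).2 ⟨hm, by omega⟩⟩

theorem isReducedExpression_append (hn : 2 ≤ n) {m : List (affineSymmetricGroup n)}
    {w : affineSymmetricGroup n} {p : ℤ} (hp : w.1 (p + 1) < w.1 p)
    (h : IsReducedExpression m (w * simpleReflection hn p)) :
    IsReducedExpression (m ++ [simpleReflection hn p]) w := by
  rw [isReducedExpression_iff hn] at h ⊢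
  have := inversionNumber_mul_of_gt hn w hp
  constructor
  · have := isExpression_append h.1 (isExpression_singleton hn p)
    rwa [mul_simpleReflection_cancel] at this
  · rw [List.length_append, List.length_singleton]
    push_cast
    linarith [h.2]

theorem exists_reducedExpression (hn : 2 ≤ n) (w : affineSymmetricGroup n) :
    ∃ l, IsReducedExpression l w := by
  obtain ⟨k, hk⟩ := Int.eq_ofNat_of_zero_le (inversionNumber_nonneg w)
  obtain ⟨l, hl, hlk⟩ := exists_expression hn k w hk
  exact ⟨l, (isReducedExpression_iff hn).2 ⟨hl, by omega⟩⟩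

theorem simpleReflection_comm (hn : 2 ≤ n) {p q : ℤ} (h0 : ¬ p ≡ q [ZMOD n])
    (h1 : ¬ p + 1 ≡ q [ZMOD n]) (h2 : ¬ q + 1 ≡ p [ZMOD n]) :
    simpleReflection hn p * simpleReflection hn q =
      simpleReflection hn q * simpleReflection hn p := by
  have aux : ∀ {a b m : ℤ}, ¬ a ≡ b [ZMOD n] → ¬ a + 1 ≡ b [ZMOD n] → ¬ b + 1 ≡ a [ZMOD n] →
      (m ≡ a [ZMOD n] ∨ m ≡ a + 1 [ZMOD n]) → reflectionFun n b m = m := by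
    intro a b m h0 h1 h2 h
    rcases h with h | h
    · exact reflectionFun_other (fun h' => h0 (h.symm.trans h')) (fun h' => h2 (h'.symm.trans h))
    · refine reflectionFun_other (fun h' => h1 (h.symm.trans h')) (fun h' => h0 ?_)
      simpa using (h.symm.trans h').sub_right 1
  have aux2 : ∀ {a m : ℤ}, (m ≡ a [ZMOD n] ∨ m ≡ a + 1 [ZMOD n]) →
      (reflectionFun n a m ≡ a [ZMOD n] ∨ reflectionFun n a m ≡ a + 1 [ZMOD n]) := by
    rintro a m (h | h)
    · rw [reflectionFun_left h]; exact Or.inr (h.add_right 1)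
    · rw [reflectionFun_right hn h]; left; simpa using h.sub_right 1
  refine Subtype.ext (Equiv.ext fun m => ?_)
  rw [mul_simpleReflection_apply, mul_simpleReflection_apply, simpleReflection_apply,
    simpleReflection_apply]
  by_cases hp : m ≡ p [ZMOD n] ∨ m ≡ p + 1 [ZMOD n]
  · rw [aux h0 h1 h2 hp, aux h0 h1 h2 (aux2 hp)]
  by_cases hq : m ≡ q [ZMOD n] ∨ m ≡ q + 1 [ZMOD n]
  · have h0' : ¬ q ≡ p [ZMOD n] := fun h => h0 h.symm
    rw [aux h0' h2 h1 hq, aux h0' h2 h1 (aux2 hq)]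
  push Not at hp hq
  rw [reflectionFun_other hp.1 hp.2, reflectionFun_other hq.1 hq.2,
    reflectionFun_other hp.1 hp.2]

theorem commutingMove_append {l l' : List (affineSymmetricGroup n)}
    (h : Relation.ReflTransGen CommutingMove l l') (m : List (affineSymmetricGroup n)) :
    Relation.ReflTransGen CommutingMove (l ++ m) (l' ++ m) := by
  refine h.lift (fun l => l ++ m) ?_
  rintro _ _ ⟨a, b, s, t, hst, rfl, rfl⟩
  exact ⟨a, b ++ m, s, t, hst, by simp, by simp⟩

/-- The last letters `s_p`, `s_q` of the two words are right descents of `w`. Adjacent descents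
would form a 321, so the letters coincide or commute. In the second case a reduced word of `w s_p
s_q`, followed by `s_q s_p` or by `s_p s_q`, links the two words by induction. -/
theorem connected_of_avoids (hn : 2 ≤ n) (k : ℕ) (w : affineSymmetricGroup n)
    (hk : inversionNumber w = k) (hw : Avoids321 w) (l l' : List (affineSymmetricGroup n))
    (hl : IsReducedExpression l w) (hl' : IsReducedExpression l' w) :
    Relation.ReflTransGen CommutingMove l l' := by
  induction k generalizing w l l' with
  | zero =>
    have h1 := ((isReducedExpression_iff hn).1 hl).2
    have h2 := ((isReducedExpression_iff hn).1 hl').2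
    rw [List.length_eq_zero_iff.1 (show l.length = 0 by push_cast at hk; omega),
      List.length_eq_zero_iff.1 (show l'.length = 0 by push_cast at hk; omega)]
  | succ k ih =>
    have h1 := ((isReducedExpression_iff hn).1 hl).2
    have h2 := ((isReducedExpression_iff hn).1 hl').2
    rcases l.eq_nil_or_concat' with rfl | ⟨m, s, rfl⟩
    · push_cast at hk; simp at h1; omega
    rcases l'.eq_nil_or_concat' with rfl | ⟨m', s', rfl⟩
    · push_cast at hk; simp at h2; omega
    obtain ⟨p, rfl, hp, hm⟩ := isReducedExpression_concat hn hl
    obtain ⟨q, rfl, hq, hm'⟩ := isReducedExpression_concat hn hl'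
    have hip := inversionNumber_mul_of_gt hn w hp
    have hiq := inversionNumber_mul_of_gt hn w hq
    push_cast at hk
    by_cases hpq : p ≡ q [ZMOD n]
    · have := simpleReflection_congr hn hpq
      rw [← this] at hm' ⊢
      exact commutingMove_append (ih _ (by omega) (Avoids321_mul hn hw hp) _ _ hm hm') _
    have adj : ∀ a b : ℤ, w.1 (a + 1) < w.1 a → w.1 (b + 1) < w.1 b → ¬ a + 1 ≡ b [ZMOD n] :=
      fun a b ha hb hab =>
        hw a (a + 1) (a + 1 + 1) (by omega) (by omega) ha (modEq_apply_gt hab hb)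
    have hpq1 := adj p q hp hq
    have hqp1 := adj q p hq hp
    have desc : ∀ a b : ℤ, ¬ a ≡ b [ZMOD n] → ¬ a + 1 ≡ b [ZMOD n] → ¬ b + 1 ≡ a [ZMOD n] →
        w.1 (b + 1) < w.1 b →
        (w * simpleReflection hn a).1 (b + 1) < (w * simpleReflection hn a).1 b := by
      intro a b h0 h1 h2 hb
      rwa [mul_simpleReflection_apply, mul_simpleReflection_apply, reflectionFun_other h2
        (fun h => h0 (by simpa using (h.sub_right 1).symm)),
        reflectionFun_other (fun h => h0 h.symm) (fun h => h1 h.symm)]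
    have hcomm := simpleReflection_comm hn hpq hpq1 hqp1
    obtain ⟨m₀, hm₀⟩ := exists_reducedExpression hn (w * simpleReflection hn p * simpleReflection hn q)
    have hm₀' : IsReducedExpression m₀ (w * simpleReflection hn q * simpleReflection hn p) := by
      rwa [mul_assoc, ← hcomm, ← mul_assoc]
    have r1 := isReducedExpression_append hn (desc p q hpq hpq1 hqp1 hq) hm₀
    have r2 := isReducedExpression_append hn (desc q p (fun h => hpq h.symm) hqp1 hpq1 hp) hm₀'
    have c1 := commutingMove_append (ih _ (by omega) (Avoids321_mul hn hw hp) _ _ hm r1)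
      [simpleReflection hn p]
    have c2 := commutingMove_append (ih _ (by omega) (Avoids321_mul hn hw hq) _ _ r2 hm')
      [simpleReflection hn q]
    refine (c1.tail ?_).trans c2
    exact ⟨m₀, [], simpleReflection hn q, simpleReflection hn p, hcomm.symm, by simp, by simp⟩

theorem not_modEq_succ_succ (hn : 3 ≤ n) (p : ℤ) : ¬ p + 1 + 1 ≡ p [ZMOD n] := by
  intro h
  have h2 : (n : ℤ) ∣ 2 := by
    have := dvd_neg.2 (Int.modEq_iff_dvd.1 h)
    ring_nf at this
    simpa using this
  have := Int.le_of_dvd two_pos h2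
  omega

theorem simpleReflection_braid (hn : 2 ≤ n) (hn3 : 3 ≤ n) (p : ℤ) :
    simpleReflection hn p * simpleReflection hn (p + 1) * simpleReflection hn p =
      simpleReflection hn (p + 1) * simpleReflection hn p * simpleReflection hn (p + 1) := by
  have n1 := not_modEq_succ hn
  have n2 := not_modEq_succ_succ hn3
  have h01 : ∀ {m}, m ≡ p [ZMOD n] → reflectionFun n p m = m + 1 := fun h => reflectionFun_left h
  have h02 : ∀ {m}, m ≡ p [ZMOD n] → reflectionFun n (p + 1) m = m := fun h =>
    reflectionFun_other (fun h' => n1 p (h'.symm.trans h)) (fun h' => n2 p (h'.symm.trans h))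
  have h11 : ∀ {m}, m ≡ p + 1 [ZMOD n] → reflectionFun n p m = m - 1 := fun h =>
    reflectionFun_right hn h
  have h12 : ∀ {m}, m ≡ p + 1 [ZMOD n] → reflectionFun n (p + 1) m = m + 1 := fun h =>
    reflectionFun_left h
  have h21 : ∀ {m}, m ≡ p + 1 + 1 [ZMOD n] → reflectionFun n p m = m := fun h =>
    reflectionFun_other (fun h' => n2 p (h.symm.trans h')) (fun h' => n1 (p + 1) (h.symm.trans h'))
  have h22 : ∀ {m}, m ≡ p + 1 + 1 [ZMOD n] → reflectionFun n (p + 1) m = m - 1 := fun h =>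
    reflectionFun_right hn h
  have down : ∀ {m a : ℤ}, m ≡ a + 1 [ZMOD n] → m - 1 ≡ a [ZMOD n] := fun h => by
    simpa using h.sub_right 1
  refine Subtype.ext (Equiv.ext fun m => ?_)
  simp only [mul_simpleReflection_apply, simpleReflection_apply]
  by_cases h0 : m ≡ p [ZMOD n]
  · rw [h01 h0, h12 (h0.add_right 1), h21 ((h0.add_right 1).add_right 1), h02 h0, h01 h0,
      h12 (h0.add_right 1)]
  by_cases h1 : m ≡ p + 1 [ZMOD n]
  · rw [h11 h1, h02 (down h1), h01 (down h1), h12 h1, h21 (h1.add_right 1), h22 (h1.add_right 1)]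
    ring
  by_cases h2 : m ≡ p + 1 + 1 [ZMOD n]
  · rw [h21 h2, h22 h2, h11 (down h2), h02 (down (down h2))]
  rw [reflectionFun_other h0 h1, reflectionFun_other h1 h2, reflectionFun_other h0 h1,
    reflectionFun_other h1 h2]

/-- Induction on the inversion number plus the width `k - i` of the triple. Three neighbours yield
the braid directly. Otherwise the position next to an end, inside the triple, either gives a
narrower 321 or forms a descent with that end; removing this descent lowers the inversion number and
does not widen the triple. -/
theorem exists_braid (hn : 2 ≤ n) (M : ℕ) (w : affineSymmetricGroup n) (i j k : ℤ)
    (hM : inversionNumber w + (k - i) ≤ M) (hij : i < j) (hjk : j < k) (h1 : w.1 j < w.1 i)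
    (h2 : w.1 k < w.1 j) :
    3 ≤ n ∧ ∃ a b p, IsReducedExpression
      (a ++ [simpleReflection hn p, simpleReflection hn (p + 1), simpleReflection hn p] ++ b) w := by
  induction M generalizing w i j k with
  | zero =>
    have := inversionNumber_nonneg w
    push_cast at hM
    omega
  | succ M ih =>
    push_cast at hM
    have step : ∀ p, w.1 (p + 1) < w.1 p → reflectionFun n p k - reflectionFun n p i ≤ k - i →
        reflectionFun n p i < reflectionFun n p j → reflectionFun n p j < reflectionFun n p k →
        3 ≤ n ∧ ∃ a b p, IsReducedExpression
          (a ++ [simpleReflection hn p, simpleReflection hn (p + 1), simpleReflection hn p] ++ b)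
            w := by
      intro p hp hle hij' hjk'
      have hi := inversionNumber_mul_of_gt hn w hp
      have hinv : ∀ m, (w * simpleReflection hn p).1 (reflectionFun n p m) = w.1 m := fun m => by
        rw [mul_simpleReflection_apply, reflectionFun_involutive hn p]
      obtain ⟨h3, a, b, q, hq⟩ := ih (w * simpleReflection hn p) _ _ _ (by omega) hij' hjk'
        (by rwa [hinv, hinv]) (by rwa [hinv, hinv])
      refine ⟨h3, a, b ++ [simpleReflection hn p], q, ?_⟩
      have := isReducedExpression_append hn hp hq
      rwa [List.append_assoc (_ ++ _)] at this
    by_cases hij1 : j = i + 1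
    · subst hij1
      by_cases hjk1 : k = i + 1 + 1
      · subst hjk1
        -- For `n = 2` the value at `i + 2` is `w i + 2`, too large to end the triple.
        have hn3 : 3 ≤ n := by
          by_contra hc
          have : i + 1 + 1 = i + 1 * (n : ℤ) := by
            have : n = 2 := by omega
            subst this; push_cast; ring
          rw [this, apply_add_mul] at h2
          have : (0 : ℤ) ≤ n := by positivity
          linarith
        refine ⟨hn3, ?_⟩
        have e1 : reflectionFun n i (i + 1 + 1) = i + 1 + 1 :=
          reflectionFun_other (not_modEq_succ_succ hn3 i) (not_modEq_succ hn (i + 1))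
        have e2 : reflectionFun n (i + 1) i = i :=
          reflectionFun_other (fun h => not_modEq_succ hn i h.symm)
            (fun h => not_modEq_succ_succ hn3 i h.symm)
        obtain ⟨m, hm⟩ := exists_reducedExpression hn
          (w * simpleReflection hn i * simpleReflection hn (i + 1) * simpleReflection hn i)
        refine ⟨m, [], i, ?_⟩
        have r3 := isReducedExpression_append hn (p := i) (by
          simp only [mul_simpleReflection_apply, reflectionFun_self, e1, e2]
          exact h2) hm
        have r2 := isReducedExpression_append hn (p := i + 1) (by
          simp only [mul_simpleReflection_apply, reflectionFun_succ hn, e1]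
          exact h2.trans h1) r3
        have r1 := isReducedExpression_append hn h1 r2
        simpa using r1
      · rcases lt_or_gt_of_ne (show w.1 (k - 1) ≠ w.1 (i + 1) from fun h => by
          have := w.1.injective h; omega) with hx | hx
        · exact ih w i (i + 1) (k - 1) (by omega) (by omega) (by omega) h1 hx
        · have e : k - 1 + 1 = k := by ring
          have hk : reflectionFun n (k - 1) k = k - 1 := by
            conv_lhs => rw [← e]
            rw [e]
            exact reflectionFun_right hn (by rw [e])
          -- The reflection may also move `i` to the left by one, but `k` moves left by one as well.
          have hib : i - 1 ≤ reflectionFun n (k - 1) i := by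
            rw [reflectionFun]; split_ifs <;> omega
          refine step (k - 1) (by rw [e]; omega) (by omega) ?_ ?_
          · refine reflectionFun_lt hn (by omega) ?_
            -- If `i` and `j` were swapped, `j` and `k` would be congruent, but `w` increases on a
            -- residue class.
            rintro ⟨hc, -⟩
            have hc' : i + 1 ≡ k [ZMOD n] := by simpa using hc.add_right 1
            exact absurd (apply_lt_of_modEq (w := w) hc' hjk) h2.not_gt
          · exact reflectionFun_lt hn (by omega) (fun hc => hjk1 hc.2)
    · rcases lt_or_gt_of_ne (show w.1 (i + 1) ≠ w.1 j from fun h => by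
          have := w.1.injective h; omega) with hx | hx
      · have hkb : reflectionFun n i k ≤ k + 1 := by
          rw [reflectionFun]; split_ifs <;> omega
        refine step i (by omega) (by rw [reflectionFun_self]; omega) ?_ ?_
        · exact reflectionFun_lt hn (by omega) (fun hc => hij1 hc.2)
        · refine reflectionFun_lt hn (by omega) ?_
          rintro ⟨hc, -⟩
          exact absurd (apply_lt_of_modEq (w := w) hc.symm hij) h1.not_gt
      · exact ih w (i + 1) j k (by omega) (by omega) (by omega) hx h2

theorem perm_of_commutingMoves {l l' : List (affineSymmetricGroup n)}
    (h : Relation.ReflTransGen CommutingMove l l') : l.Perm l' := by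
  induction h with
  | refl => exact List.Perm.refl _
  | tail _ h ih =>
    obtain ⟨a, b, s, t, -, rfl, rfl⟩ := h
    exact ih.trans (List.Perm.append_left a (List.Perm.swap t s b))

/-- Commuting moves keep the multiset of letters, whereas `s_p s_{p+1} s_p` and `s_{p+1} s_p
s_{p+1}` contain `s_p` a different number of times. So a 321 produces two reduced words that are not
connected. -/
theorem isFullyCommutative_iff (hn : 2 ≤ n) (w : affineSymmetricGroup n) :
    IsFullyCommutative w ↔ Avoids321 w := by
  constructor
  · intro h i j k hij hjk h1 h2
    obtain ⟨hn3, a, b, p, hr⟩ := exists_braid hn (inversionNumber w + (k - i)).toNat w i j k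
      (Int.self_le_toNat _) hij hjk h1 h2
    have hr' : IsReducedExpression (a ++ [simpleReflection hn (p + 1), simpleReflection hn p,
        simpleReflection hn (p + 1)] ++ b) w := by
      rw [isReducedExpression_iff hn] at hr ⊢
      obtain ⟨⟨g1, g2⟩, g3⟩ := hr
      refine ⟨⟨?_, ?_⟩, by simpa using g3⟩
      · intro s hs
        apply g1
        simp only [List.mem_append, List.mem_cons, List.not_mem_nil] at hs ⊢
        tauto
      · rw [← g2]
        have := simpleReflection_braid hn hn3 p
        simp only [List.prod_append, List.prod_cons, List.prod_nil, mul_one, ← mul_assoc] at this ⊢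
        rw [mul_assoc a.prod, mul_assoc a.prod, ← this]
        simp only [mul_assoc]
    have hperm := perm_of_commutingMoves (h _ _ hr hr')
    rw [List.perm_append_right_iff, List.perm_append_left_iff] at hperm
    have hne : simpleReflection hn (p + 1) ≠ simpleReflection hn p := by
      intro h
      have h3 := congrArg (fun s : affineSymmetricGroup n => s.1 p) h
      simp only [simpleReflection_apply, reflectionFun_self] at h3
      rw [reflectionFun_other (fun h => not_modEq_succ hn p h.symm)
            (fun h => not_modEq_succ_succ hn3 p h.symm)] at h3
      omega
    classical
    have := hperm.count_eq (simpleReflection hn p)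
    simp [hne] at this
  · intro h l l' hl hl'
    obtain ⟨k, hk⟩ := Int.eq_ofNat_of_zero_le (inversionNumber_nonneg w)
    exact connected_of_avoids hn k w hk h l l' hl hl'

/-! ### Longness in terms of the window -/

theorem mem_abacus {w : affineSymmetricGroup n} {b : ℤ}
    (hb : b ∈ Finset.Icc (1 : ℤ) n) (q : ℤ) : w.1 (b + q * n) ∈ abacus w ↔ q ≤ 0 := by
  constructor
  · rintro ⟨a, ha, k, h⟩
    have : w.1 (b + q * n) = w.1 (a + (-k : ℤ) * n) := by rw [h, apply_add_mul]; ring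
    have := w.1.injective this
    have := window_unique ha hb (q := q + k) (by linarith)
    omega
  · intro hq
    refine ⟨b, hb, q.natAbs, ?_⟩
    rw [apply_add_mul, Int.ofNat_natAbs_of_nonpos hq]
    ring

/-- The last bead is the largest window entry and the first gap is `n` above the smallest one.
Normalizing puts this gap at `n + 1`, hence the last bead at `max - min + 1`. -/
theorem isLong_iff (hn : 0 < n) (w : affineSymmetricGroup n) :
    IsLong w ↔ ∃ i ∈ Finset.Icc (1 : ℤ) n, ∃ j ∈ Finset.Icc (1 : ℤ) n,
      2 * (n : ℤ) ≤ w.1 i - w.1 j := by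
  have hn' : (0 : ℤ) < n := by exact_mod_cast hn
  constructor
  · rintro ⟨_, t, ⟨⟨d, rfl⟩, hleast⟩, hgr, ht⟩
    obtain ⟨_, ⟨a, ha, k, rfl⟩, rfl⟩ := hgr.1
    obtain ⟨x, hx⟩ := w.1.surjective (n + 1 - d)
    obtain ⟨b, hb, q, rfl⟩ := exists_window hn x
    have hq : ¬ q ≤ 0 := by
      intro h
      apply hleast.1
      exact ⟨_, (mem_abacus hb q).2 h, by rw [hx]; ring⟩
    refine ⟨a, ha, b, hb, ?_⟩
    rw [apply_add_mul] at hx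
    simp only at ht
    have h1 : (0 : ℤ) ≤ k * n := by positivity
    have h2 : (1 : ℤ) * n ≤ q * n := mul_le_mul_of_nonneg_right (by omega) hn'.le
    linarith
  · rintro ⟨a, ha, b, hb, hab⟩
    obtain ⟨i, hi, himax⟩ := Finset.exists_max_image (Finset.Icc (1 : ℤ) n) (fun j => w.1 j) ⟨a, ha⟩
    obtain ⟨j, hj, hjmin⟩ := Finset.exists_min_image (Finset.Icc (1 : ℤ) n) (fun j => w.1 j) ⟨a, ha⟩
    refine ⟨(fun p => p + (1 - w.1 j)) '' abacus w, w.1 i + (1 - w.1 j),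
      ⟨⟨_, rfl⟩, ?_, ?_⟩, ⟨⟨w.1 i, ?_, rfl⟩, ?_⟩, ?_⟩
    · rintro ⟨p, hp, he⟩
      have : p = w.1 (j + 1 * n) := by rw [apply_add_mul]; simp only at he; linarith
      rw [this, mem_abacus hj] at hp
      omega
    · intro g hg
      obtain ⟨x, hx⟩ := w.1.surjective (g - (1 - w.1 j))
      obtain ⟨c, hc, q, rfl⟩ := exists_window hn x
      have hq : ¬ q ≤ 0 := by
        intro h
        exact hg ⟨_, (mem_abacus hc q).2 h, by rw [hx]; ring⟩
      rw [apply_add_mul] at hx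
      have h2 : (1 : ℤ) * n ≤ q * n := mul_le_mul_of_nonneg_right (by omega) hn'.le
      have := hjmin c hc
      linarith
    · simpa using (mem_abacus (w := w) hi 0).2 le_rfl
    · rintro _ ⟨_, ⟨c, hc, k, rfl⟩, rfl⟩
      have := himax c hc
      have h1 : (0 : ℤ) ≤ k * n := by positivity
      simp only
      linarith
    · have := himax a ha
      have := hjmin b hb
      linarith

/-! ### Enumerating unions of residue classes -/

/-- The increasing enumeration of the integers congruent modulo `n` to `y + 1` for some `y ∈ S`,
which starts at `0` with the smallest positive one. -/
noncomputable def enum (n : ℕ) (S : Finset ℕ) (i : ℤ) : ℤ :=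
  Nat.nth (· ∈ S) (i % S.card).toNat + 1 + n * (i / S.card)

section nth

variable {S : Finset ℕ}

theorem nth_mem {i : ℕ} (hi : i < S.card) : Nat.nth (· ∈ S) i ∈ S :=
  Nat.nth_mem_of_lt_card (p := (· ∈ S)) S.finite_toSet (by
    rwa [show S.finite_toSet.toFinset = S from Finset.finite_toSet_toFinset S])

theorem nth_lt {i j : ℕ} (hij : i < j) (hj : j < S.card) :
    Nat.nth (· ∈ S) i < Nat.nth (· ∈ S) j :=
  Nat.nth_lt_nth_of_lt_card (p := (· ∈ S)) S.finite_toSet hij (by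
    rwa [show S.finite_toSet.toFinset = S from Finset.finite_toSet_toFinset S])

theorem exists_nth_eq {x : ℕ} (hx : x ∈ S) : ∃ i < S.card, Nat.nth (· ∈ S) i = x := by
  obtain ⟨i, hi, h⟩ := Nat.exists_lt_card_finite_nth_eq (p := (· ∈ S)) S.finite_toSet hx
  rw [show S.finite_toSet.toFinset = S from Finset.finite_toSet_toFinset S] at hi
  exact ⟨i, hi, h⟩

theorem sum_nth {M : Type*} [AddCommMonoid M] (f : ℕ → M) :
    ∑ i ∈ Finset.range S.card, f (Nat.nth (· ∈ S) i) = ∑ x ∈ S, f x := by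
  refine Finset.sum_bij (fun i _ => Nat.nth (· ∈ S) i) ?_ ?_ ?_ ?_
  · intro i hi
    exact nth_mem (Finset.mem_range.1 hi)
  · intro i hi j hj h
    rw [Finset.mem_range] at hi hj
    rcases lt_trichotomy i j with h' | h' | h'
    · exact absurd h (nth_lt h' hj).ne
    · exact h'
    · exact absurd h (nth_lt h' hi).ne'
  · intro x hx
    obtain ⟨i, hi, h⟩ := exists_nth_eq hx
    exact ⟨i, Finset.mem_range.2 hi, h⟩
  · intros; rfl

end nth

section enum

variable {S : Finset ℕ}

theorem enum_add_mul (h0 : 0 < S.card) (i q : ℤ) :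
    enum n S (i + q * S.card) = enum n S i + q * n := by
  have : (S.card : ℤ) ≠ 0 := by positivity
  rw [enum, enum, Int.add_mul_emod_self_right, Int.add_mul_ediv_right _ _ this]
  ring

theorem enum_natCast {i : ℕ} (hi : i < S.card) : enum n S i = Nat.nth (· ∈ S) i + 1 := by
  have h1 : ((i : ℤ) % S.card).toNat = i := by
    rw [Int.emod_eq_of_lt (by positivity) (by exact_mod_cast hi)]; simp
  have h2 : (i : ℤ) / S.card = 0 := Int.ediv_eq_zero_of_lt (by positivity) (by exact_mod_cast hi)
  rw [enum, h1, h2]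
  ring

theorem exists_index (h0 : 0 < S.card) (i : ℤ) : ∃ (r : ℕ) (q : ℤ), r < S.card ∧
    i = r + q * S.card := by
  have h : (0 : ℤ) < S.card := by exact_mod_cast h0
  have h1 := Int.emod_nonneg i h.ne'
  have h2 := Int.emod_lt_of_pos i h
  refine ⟨(i % S.card).toNat, i / S.card, by omega, ?_⟩
  rw [Int.toNat_of_nonneg h1]
  have := Int.emod_add_mul_ediv i S.card
  linarith

theorem enum_strictMono (hS : S ⊆ Finset.range n) (h0 : 0 < S.card) : StrictMono (enum n S) := by
  refine strictMono_int_of_lt_succ fun i => ?_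
  obtain ⟨r, q, hr, rfl⟩ := exists_index h0 i
  by_cases h : r + 1 < S.card
  · rw [show (r : ℤ) + q * S.card + 1 = ((r + 1 : ℕ) : ℤ) + q * S.card by push_cast; ring,
      enum_add_mul h0, enum_add_mul h0, enum_natCast hr, enum_natCast h]
    have := nth_lt (Nat.lt_succ_self r) h
    have : (Nat.nth (· ∈ S) r : ℤ) < Nat.nth (· ∈ S) (r + 1) := by exact_mod_cast this
    linarith
  · have h1 : r + 1 = S.card := by omega
    have h2 : (r : ℤ) + 1 = S.card := by exact_mod_cast h1
    rw [show (r : ℤ) + q * S.card + 1 = ((0 : ℕ) : ℤ) + (q + 1) * S.card by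
        push_cast; rw [← h2]; ring,
      enum_add_mul h0, enum_add_mul h0, enum_natCast hr, enum_natCast h0]
    have : (Nat.nth (· ∈ S) r : ℤ) < n := by exact_mod_cast Finset.mem_range.1 (hS (nth_mem hr))
    have : (0 : ℤ) ≤ Nat.nth (· ∈ S) 0 := by positivity
    linarith

theorem exists_enum_iff (hS : S ⊆ Finset.range n) (h0 : 0 < S.card) {y : ℕ} (hy : y < n) (q : ℤ) :
    (∃ i, enum n S i = y + 1 + q * n) ↔ y ∈ S := by
  constructor
  · rintro ⟨i, hi⟩
    obtain ⟨r, q', hr, rfl⟩ := exists_index h0 i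
    rw [enum_add_mul h0, enum_natCast hr] at hi
    have h1 := nth_mem hr
    have h2 : Nat.nth (· ∈ S) r < n := Finset.mem_range.1 (hS h1)
    have h3 : q' - q = 0 := window_unique (n := n) (i := (y : ℤ) + 1)
      (j := (Nat.nth (· ∈ S) r : ℤ) + 1) (by rw [Finset.mem_Icc]; omega)
      (by rw [Finset.mem_Icc]; omega) (by linarith)
    have h4 : q' = q := by omega
    subst h4
    have h5 : Nat.nth (· ∈ S) r = y := by
      have : (Nat.nth (· ∈ S) r : ℤ) = y := by linarith
      exact_mod_cast this
    rwa [h5] at h1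
  · intro h
    obtain ⟨r, hr, rfl⟩ := exists_nth_eq h
    exact ⟨r + q * S.card, by rw [enum_add_mul h0, enum_natCast hr]⟩

theorem exists_residue (hn : 0 < n) (x : ℤ) : ∃ y : ℕ, y < n ∧ ∃ q : ℤ, x = y + 1 + q * n := by
  obtain ⟨i, hi, q, rfl⟩ := exists_window hn x
  rw [Finset.mem_Icc] at hi
  exact ⟨(i - 1).toNat, by omega, q, by rw [Int.toNat_of_nonneg (by omega)]; ring⟩

theorem add_le_of_strictMono {f : ℤ → ℤ} (hf : StrictMono f) {i j : ℤ} (hij : i ≤ j) :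
    f i + (j - i) ≤ f j := by
  induction j, hij using Int.leInduction with
  | base => simp
  | succ j _ ih =>
    have := hf (lt_add_one j)
    omega

theorem lt_enum (hS : S ⊆ Finset.range n) (h0 : 0 < S.card) {i q : ℤ} (h : q * S.card ≤ i) :
    q * n < enum n S i := by
  have h1 := (enum_strictMono hS h0).monotone h
  have h2 := enum_add_mul (n := n) h0 0 q
  have h3 := enum_natCast (n := n) h0
  rw [zero_add] at h2
  push_cast at h3
  rw [h2, h3] at h1
  have : (0 : ℤ) ≤ Nat.nth (· ∈ S) 0 := by positivity
  linarith

theorem enum_le (hS : S ⊆ Finset.range n) (h0 : 0 < S.card) {i q : ℤ} (h : i < q * S.card) :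
    enum n S i ≤ q * n := by
  have h1 := (enum_strictMono hS h0).monotone (show i ≤ ((S.card - 1 : ℕ) : ℤ) + (q - 1) * S.card by
    rw [Nat.cast_sub h0]; push_cast; linarith)
  rw [enum_add_mul h0, enum_natCast (by omega)] at h1
  have : (Nat.nth (· ∈ S) (S.card - 1) : ℤ) < n := by
    exact_mod_cast Finset.mem_range.1 (hS (nth_mem (by omega)))
  linarith

/-- With `k = H.card` and `0 ≤ r < k`, the entry of `A` with index `r` is at most `n - (k - 1 - r)`,
since larger ones must fit below `n`; that of `H` with index `r + 1` is at least `r + 2`. This is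
what makes a shift `c > k` move high positions right and low ones left. -/
theorem enum_lt_enum {A H : Finset ℕ} (hA : A ⊆ Finset.range n) (hH : H ⊆ Finset.range n)
    (h0 : 0 < H.card) (hAH : A.card = H.card) (i : ℤ) :
    enum n A i + H.card < enum n H (i + H.card + 1) := by
  have h0' : 0 < A.card := by omega
  obtain ⟨r, q, hr, rfl⟩ := exists_index h0' i
  have h1 : enum n A r ≤ n - (A.card - 1 - r) := by
    have h2 := enum_le hA h0' (i := (A.card : ℤ) - 1) (q := 1) (by linarith)
    have := add_le_of_strictMono (enum_strictMono hA h0') (show (r : ℤ) ≤ A.card - 1 by omega)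
    linarith
  have h2 : (r : ℤ) + 2 ≤ enum n H (r + 1) := by
    have h2 := lt_enum hH h0 (i := 0) (q := 0) (by simp)
    have := add_le_of_strictMono (enum_strictMono hH h0) (show 0 ≤ (r : ℤ) + 1 by omega)
    linarith
  rw [enum_add_mul h0', hAH,
    show (r : ℤ) + q * H.card + H.card + 1 = (r + 1) + (q + 1) * H.card by ring, enum_add_mul h0]
  rw [hAH] at h1
  linarith

theorem sum_enum {M : Type*} [AddCommMonoid M] (f : ℤ → M) :
    ∑ i ∈ Finset.range S.card, f (enum n S i) = ∑ y ∈ S, f (y + 1) := by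
  rw [← sum_nth fun y : ℕ => f (y + 1)]
  exact Finset.sum_congr rfl fun i hi => by rw [enum_natCast (Finset.mem_range.1 hi)]

/-- Raising the shift by one replaces the first term by its translate by `n`. -/
theorem sum_enum_shift (h0 : 0 < S.card) (c : ℤ) :
    ∑ i ∈ Finset.range S.card, enum n S (i + c) = ∑ y ∈ S, (y : ℤ) + S.card + n * c := by
  have step : ∀ c : ℤ, ∑ i ∈ Finset.range S.card, enum n S (i + (c + 1)) =
      ∑ i ∈ Finset.range S.card, enum n S (i + c) + n := by
    intro c
    have h1 := Finset.sum_range_succ (fun i : ℕ => enum n S (i + c)) S.card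
    have h2 := Finset.sum_range_succ' (fun i : ℕ => enum n S (i + c)) S.card
    have h3 := enum_add_mul (n := n) h0 c 1
    rw [one_mul, one_mul] at h3
    rw [add_comm (S.card : ℤ) c, h3] at h1
    simp only [Nat.cast_add, Nat.cast_one, Nat.cast_zero, zero_add] at h2
    simp only [show ∀ i : ℕ, (i : ℤ) + 1 + c = i + (c + 1) from fun i => by ring] at h2
    linarith
  induction c using Int.induction_on with
  | zero =>
    simp only [add_zero, mul_zero]
    rw [sum_enum fun x => x, Finset.sum_add_distrib]
    simp
  | succ c ih => rw [step, ih]; ring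
  | pred c ih =>
    have := step (-(c : ℤ) - 1)
    rw [sub_add_cancel, ih] at this
    linarith

theorem sum_window_eq_range {M : Type*} [AddCommMonoid M] (f : ℤ → M) :
    ∑ x ∈ Finset.Icc (1 : ℤ) n, f x = ∑ y ∈ Finset.range n, f (y + 1) := by
  symm
  refine Finset.sum_bij (fun y _ => (y : ℤ) + 1) ?_ ?_ ?_ ?_
  · intro y hy
    rw [Finset.mem_range] at hy
    rw [Finset.mem_Icc]; omega
  · intro a _ b _ h
    omega
  · intro x hx
    rw [Finset.mem_Icc] at hx
    exact ⟨(x - 1).toNat, by rw [Finset.mem_range]; omega, by omega⟩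
  · intros; rfl

theorem sum_window_split {M : Type*} [AddCommMonoid M] (hS : S ⊆ Finset.range n) (f : ℤ → M) :
    ∑ x ∈ Finset.Icc (1 : ℤ) n, f x = ∑ i ∈ Finset.range S.card, f (enum n S i) +
      ∑ j ∈ Finset.range (Finset.range n \ S).card, f (enum n (Finset.range n \ S) j) := by
  rw [sum_enum, sum_enum, sum_window_eq_range, ← Finset.sum_sdiff hS, add_comm]

theorem card_compl (hS : S ⊆ Finset.range n) : ((Finset.range n \ S).card : ℤ) = n - S.card := by
  have := Finset.card_sdiff_add_card_eq_card hS
  rw [Finset.card_range] at this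
  omega

theorem enum_or (hS : S ⊆ Finset.range n) (h0 : 0 < S.card) (h1 : S.card < n) (x : ℤ) :
    (∃ i, x = enum n S i) ∨ ∃ j, x = enum n (Finset.range n \ S) j := by
  obtain ⟨y, hy, q, rfl⟩ := exists_residue (show 0 < n by omega) x
  by_cases h : y ∈ S
  · left
    obtain ⟨i, hi⟩ := (exists_enum_iff hS h0 hy q).2 h
    exact ⟨i, hi.symm⟩
  · right
    have := card_compl hS
    obtain ⟨i, hi⟩ := (exists_enum_iff Finset.sdiff_subset (by omega) hy q).2
      (Finset.mem_sdiff.2 ⟨Finset.mem_range.2 hy, h⟩)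
    exact ⟨i, hi.symm⟩

theorem enum_ne_compl (hS : S ⊆ Finset.range n) (h0 : 0 < S.card) (h1 : S.card < n) (i j : ℤ) :
    enum n S i ≠ enum n (Finset.range n \ S) j := by
  intro h
  have := card_compl hS
  obtain ⟨y, hy, q, hx⟩ := exists_residue (show 0 < n by omega) (enum n S i)
  have h2 := (exists_enum_iff hS h0 hy q).1 ⟨i, hx⟩
  have h3 := (exists_enum_iff Finset.sdiff_subset (by omega) hy q).1 ⟨j, h ▸ hx⟩
  exact (Finset.mem_sdiff.1 h3).2 h2

/-- The integers as the disjoint union of the classes which belong to `S` and the other ones. -/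
noncomputable def enumEquiv (hS : S ⊆ Finset.range n) (h0 : 0 < S.card) (h1 : S.card < n) :
    ℤ ⊕ ℤ ≃ ℤ :=
  Equiv.ofBijective (Sum.elim (enum n S) (enum n (Finset.range n \ S))) (by
    have hc := card_compl hS
    have i1 := (enum_strictMono hS h0).injective
    have i2 := (enum_strictMono (n := n) (S := Finset.range n \ S) Finset.sdiff_subset
      (by omega)).injective
    constructor
    · refine Function.Injective.sumElim i1 i2 fun i j => enum_ne_compl hS h0 h1 i j
    · intro x
      rcases enum_or hS h0 h1 x with ⟨i, rfl⟩ | ⟨j, rfl⟩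
      exacts [⟨Sum.inl i, rfl⟩, ⟨Sum.inr j, rfl⟩])

end enum

/-! ### From the data `A`, `H`, `c` to a long 321-avoiding element -/

/-- The conditions on the sets `A` of positions and `H` of residues of the large entries. -/
structure IsPair (n : ℕ) (A H : Finset ℕ) : Prop where
  left : A ⊆ Finset.range n
  right : H ⊆ Finset.range n
  card_eq : A.card = H.card
  pos : 0 < H.card
  lt : H.card < n

/-- `w` maps the positions of `A` to the values of `H`, in order and with the shift `c` of the
enumerations, and its remaining positions to the remaining values. -/
structure HasData (w : affineSymmetricGroup n) (A H : Finset ℕ) (c : ℤ) : Prop where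
  high : ∀ i, w.1 (enum n A i) = enum n H (i + c) - H.card
  low : ∀ j, w.1 (enum n (Finset.range n \ A) j) =
    enum n (Finset.range n \ H) (j + (H.card - c)) - H.card

/-- The shifts `c` and `H.card - c` together add `n * H.card` to the window sum, which subtracting
`H.card` from each of the `n` entries cancels. -/
theorem exists_hasData {A H : Finset ℕ} (h : IsPair n A H) (c : ℤ) :
    ∃ w : affineSymmetricGroup n, HasData w A H c := by
  obtain ⟨hA, hH, hAH, h0, h1⟩ := h
  have hA0 : 0 < A.card := by omega
  have hA1 : A.card < n := by omega
  have hcA := card_compl hA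
  have hcH := card_compl hH
  let f : Equiv.Perm ℤ := (enumEquiv hA hA0 hA1).symm.trans
    ((Equiv.sumCongr (Equiv.addRight c) (Equiv.addRight ((H.card : ℤ) - c))).trans
      ((enumEquiv hH h0 h1).trans (Equiv.addRight (-(H.card : ℤ)))))
  have hf1 : ∀ i, f (enum n A i) = enum n H (i + c) - H.card := by
    intro i
    have : (enumEquiv hA hA0 hA1).symm (enum n A i) = Sum.inl i :=
      (Equiv.symm_apply_eq _).2 rfl
    simp only [f, Equiv.trans_apply, this]
    rfl
  have hf2 : ∀ j, f (enum n (Finset.range n \ A) j) =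
      enum n (Finset.range n \ H) (j + (H.card - c)) - H.card := by
    intro j
    have : (enumEquiv hA hA0 hA1).symm (enum n (Finset.range n \ A) j) = Sum.inr j :=
      (Equiv.symm_apply_eq _).2 rfl
    simp only [f, Equiv.trans_apply, this]
    rfl
  have hA0' : 0 < (Finset.range n \ A).card := by omega
  have hH0' : 0 < (Finset.range n \ H).card := by omega
  have hcard : (Finset.range n \ A).card = (Finset.range n \ H).card := by omega
  refine ⟨⟨f, ?_, ?_⟩, hf1, hf2⟩
  · intro x
    rcases enum_or hA hA0 hA1 x with ⟨i, rfl⟩ | ⟨j, rfl⟩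
    · have e := enum_add_mul (n := n) hA0 i 1
      rw [one_mul, one_mul] at e
      have e' := enum_add_mul (n := n) h0 (i + c) 1
      rw [one_mul, one_mul] at e'
      rw [← e, hf1, hf1, hAH, add_right_comm, e']
      ring
    · have e := enum_add_mul (n := n) hA0' j 1
      rw [one_mul, one_mul] at e
      have e' := enum_add_mul (n := n) hH0' (j + (H.card - c)) 1
      rw [one_mul, one_mul] at e'
      rw [← e, hf2, hf2, hcard, add_right_comm, e']
      ring
  · rw [sum_window_split hA f, Finset.sum_congr rfl fun (i : ℕ) _ => hf1 i,
      Finset.sum_congr rfl fun (j : ℕ) _ => hf2 j, Finset.sum_sub_distrib, Finset.sum_sub_distrib,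
      hAH, hcard, sum_enum_shift h0, sum_enum_shift hH0', sum_window_eq_range,
      ← Finset.sum_sdiff hH]
    simp only [Finset.sum_add_distrib, Finset.sum_const, Finset.card_range, nsmul_eq_mul, mul_one, hcH]
    ring

section hasData

variable {w : affineSymmetricGroup n} {A H : Finset ℕ} {c : ℤ}

theorem IsPair.left_pos (h : IsPair n A H) : 0 < A.card := by have := h.card_eq; have := h.pos; omega

theorem IsPair.left_lt (h : IsPair n A H) : A.card < n := by have := h.card_eq; have := h.lt; omega

theorem IsPair.left_compl_pos (h : IsPair n A H) : 0 < (Finset.range n \ A).card := by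
  have := card_compl h.left; have := h.left_lt; omega

theorem IsPair.right_compl_pos (h : IsPair n A H) : 0 < (Finset.range n \ H).card := by
  have := card_compl h.right; have := h.lt; omega

theorem HasData.unique {w' : affineSymmetricGroup n} (hp : IsPair n A H) (h : HasData w A H c)
    (h' : HasData w' A H c) : w = w' := by
  refine Subtype.ext (Equiv.ext fun x => ?_)
  rcases enum_or hp.left hp.left_pos hp.left_lt x with ⟨i, rfl⟩ | ⟨j, rfl⟩
  · rw [h.high, h'.high]
  · rw [h.low, h'.low]

theorem HasData.high_mono (hp : IsPair n A H) (h : HasData w A H c) {i j : ℤ}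
    (hij : enum n A i < enum n A j) : w.1 (enum n A i) < w.1 (enum n A j) := by
  have := (enum_strictMono hp.left hp.left_pos).lt_iff_lt.1 hij
  rw [h.high, h.high]
  have := enum_strictMono hp.right hp.pos (show i + c < j + c by omega)
  omega

theorem HasData.low_mono (hp : IsPair n A H) (h : HasData w A H c) {i j : ℤ}
    (hij : enum n (Finset.range n \ A) i < enum n (Finset.range n \ A) j) :
    w.1 (enum n (Finset.range n \ A) i) < w.1 (enum n (Finset.range n \ A) j) := by
  have := (enum_strictMono Finset.sdiff_subset hp.left_compl_pos).lt_iff_lt.1 hij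
  rw [h.low, h.low]
  have := enum_strictMono Finset.sdiff_subset hp.right_compl_pos
    (show i + (H.card - c) < j + (H.card - c) by omega)
  omega

theorem HasData.high_gt (hp : IsPair n A H) (h : HasData w A H c) (hc : (H.card : ℤ) < c) (i : ℤ) :
    enum n A i < w.1 (enum n A i) := by
  rw [h.high]
  have h1 := enum_lt_enum hp.left hp.right hp.pos hp.card_eq i
  have h2 := (enum_strictMono hp.right hp.pos).monotone (show i + H.card + 1 ≤ i + c by omega)
  omega

theorem HasData.low_lt (hp : IsPair n A H) (h : HasData w A H c) (hc : (H.card : ℤ) < c) (j : ℤ) :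
    w.1 (enum n (Finset.range n \ A) j) < enum n (Finset.range n \ A) j := by
  rw [h.low]
  have hA := card_compl hp.left
  have hH := card_compl hp.right
  have := hp.card_eq
  -- The roles are exchanged: `enum_lt_enum` is applied to the complement of `H` for the values and
  -- that of `A` for the positions. The resulting index lies one full period beyond `j`, so `n`
  -- minus the size of the complement leaves `H.card`.
  have h1 := enum_lt_enum (n := n) (A := Finset.range n \ H) (H := Finset.range n \ A)
    Finset.sdiff_subset Finset.sdiff_subset hp.left_compl_pos (by omega) (j - 1)
  have h2 := (enum_strictMono (n := n) (S := Finset.range n \ H) Finset.sdiff_subset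
    hp.right_compl_pos).monotone (show j + (H.card - c) ≤ j - 1 by omega)
  have h3 := enum_add_mul (n := n) hp.left_compl_pos j 1
  rw [show j - 1 + ((Finset.range n \ A).card : ℤ) + 1 = j + 1 * (Finset.range n \ A).card by ring,
    h3] at h1
  omega

/-- Two of any three positions lie in the same class, on which `w` increases. -/
theorem HasData.avoids (hp : IsPair n A H) (h : HasData w A H c) : Avoids321 w := by
  intro x y z hxy hyz h1 h2
  rcases enum_or hp.left hp.left_pos hp.left_lt x with ⟨i, rfl⟩ | ⟨i, rfl⟩ <;>
  rcases enum_or hp.left hp.left_pos hp.left_lt y with ⟨j, rfl⟩ | ⟨j, rfl⟩ <;>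
  rcases enum_or hp.left hp.left_pos hp.left_lt z with ⟨k, rfl⟩ | ⟨k, rfl⟩
  · exact (h.high_mono hp hxy).not_gt h1
  · exact (h.high_mono hp hxy).not_gt h1
  · exact (h.high_mono hp (hxy.trans hyz)).not_gt (h2.trans h1)
  · exact (h.low_mono hp hyz).not_gt h2
  · exact (h.high_mono hp hyz).not_gt h2
  · exact (h.low_mono hp (hxy.trans hyz)).not_gt (h2.trans h1)
  · exact (h.low_mono hp hxy).not_gt h1
  · exact (h.low_mono hp hxy).not_gt h1

theorem enum_mem_window {S : Finset ℕ} (hS : S ⊆ Finset.range n) {i : ℕ} (hi : i < S.card) :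
    enum n S i ∈ Finset.Icc (1 : ℤ) n := by
  have := Finset.mem_range.1 (hS (nth_mem hi))
  rw [enum_natCast hi, Finset.mem_Icc]
  omega

/-- The last high entry of the window has index at least `2 * H.card`, so it exceeds `2n - H.card`;
the first low one has negative index, so it is at most `-H.card`. -/
theorem HasData.isLong (hp : IsPair n A H) (h : HasData w A H c) (hc : (H.card : ℤ) < c) :
    IsLong w := by
  have h0 := hp.left_pos
  have h0' := hp.left_compl_pos
  have he := hp.card_eq
  rw [isLong_iff (by have := hp.lt; omega)]
  refine ⟨_, enum_mem_window hp.left (i := A.card - 1) (by omega), _,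
    enum_mem_window Finset.sdiff_subset h0', ?_⟩
  rw [h.high, h.low]
  have h1 := lt_enum hp.right hp.pos (i := ((A.card - 1 : ℕ) : ℤ) + c) (q := 2) (by omega)
  have h2 := enum_le (n := n) (S := Finset.range n \ H) Finset.sdiff_subset hp.right_compl_pos
    (i := ((0 : ℕ) : ℤ) + (H.card - c)) (q := 0) (by omega)
  omega

/-- Low positions have only larger values to their right. High ones have only smaller values to
their left, so `inversionCount_eq_sub` applies to them. -/
theorem HasData.inversionNumber_eq (hn : 2 ≤ n) (hp : IsPair n A H) (h : HasData w A H c)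
    (hc : (H.card : ℤ) < c) :
    inversionNumber w = ∑ y ∈ H, (y : ℤ) - ∑ y ∈ A, (y : ℤ) + n * c - H.card * H.card := by
  have hlow : ∀ j, inversionCount w (enum n (Finset.range n \ A) j) = 0 := by
    intro j
    refine inversionCount_eq_zero fun x hx => ?_
    rcases enum_or hp.left hp.left_pos hp.left_lt x with ⟨i, rfl⟩ | ⟨i, rfl⟩
    · exact ((h.low_lt hp hc j).trans hx).trans (h.high_gt hp hc i)
    · exact h.low_mono hp hx
  have hhigh : ∀ i, inversionCount w (enum n A i) = enum n H (i + c) - H.card - enum n A i := by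
    intro i
    obtain ⟨k, hk⟩ := Int.eq_ofNat_of_zero_le (inversionNumber_nonneg w)
    rw [inversionCount_eq_sub hn k w hk, h.high]
    intro x hx
    rcases enum_or hp.left hp.left_pos hp.left_lt x with ⟨j, rfl⟩ | ⟨j, rfl⟩
    · exact h.high_mono hp hx
    · exact ((h.low_lt hp hc j).trans hx).trans (h.high_gt hp hc i)
  rw [inversionNumber, sum_window_split hp.left, Finset.sum_congr rfl fun (i : ℕ) _ => hhigh i,
    Finset.sum_congr rfl fun (j : ℕ) _ => hlow j, Finset.sum_sub_distrib, Finset.sum_sub_distrib,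
    sum_enum fun x => x, hp.card_eq, sum_enum_shift hp.pos]
  simp only [Finset.sum_add_distrib, Finset.sum_const, Finset.card_range, nsmul_eq_mul, mul_one,
    hp.card_eq]
  ring

/-- `A` is recovered as the window positions that `w` moves to the right; their values then
determine `H` and `c`. -/
theorem HasData.data_unique {A' H' : Finset ℕ} {c' : ℤ} (hp : IsPair n A H)
    (h : HasData w A H c) (hc : (H.card : ℤ) < c) (hp' : IsPair n A' H') (h' : HasData w A' H' c')
    (hc' : (H'.card : ℤ) < c') : A = A' ∧ H = H' ∧ c = c' := by
  have key : ∀ {A H : Finset ℕ} {c : ℤ}, IsPair n A H → HasData w A H c → (H.card : ℤ) < c →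
      ∀ y, y ∈ A ↔ y < n ∧ (y : ℤ) + 1 < w.1 (y + 1) := by
    intro A H c hp h hc y
    constructor
    · intro hy
      have hyn := Finset.mem_range.1 (hp.left hy)
      obtain ⟨i, hi⟩ := (exists_enum_iff hp.left hp.left_pos hyn 0).2 hy
      rw [zero_mul, add_zero] at hi
      have := h.high_gt hp hc i
      rw [hi] at this
      exact ⟨hyn, this⟩
    · rintro ⟨hyn, hy⟩
      by_contra hyA
      obtain ⟨i, hi⟩ := (exists_enum_iff (n := n) (S := Finset.range n \ A) Finset.sdiff_subset
        hp.left_compl_pos hyn 0).2 (Finset.mem_sdiff.2 ⟨Finset.mem_range.2 hyn, hyA⟩)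
      rw [zero_mul, add_zero] at hi
      have := h.low_lt hp hc i
      rw [hi] at this
      exact this.not_gt hy
  have hA : A = A' := Finset.ext fun y => (key hp h hc y).trans (key hp' h' hc' y).symm
  subst hA
  have hcard : H.card = H'.card := hp.card_eq.symm.trans hp'.card_eq
  have he : ∀ i, enum n H (i + c) = enum n H' (i + c') := by
    intro i
    have := (h.high i).symm.trans (h'.high i)
    rw [hcard] at this
    omega
  have hH : H = H' := by
    ext y
    by_cases hy : y < n
    · rw [← exists_enum_iff hp.right hp.pos hy 0, ← exists_enum_iff hp'.right hp'.pos hy 0]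
      constructor
      · rintro ⟨i, hi⟩
        exact ⟨i - c + c', by rw [← he, sub_add_cancel, hi]⟩
      · rintro ⟨i, hi⟩
        exact ⟨i - c' + c, by rw [he, sub_add_cancel, hi]⟩
    · exact ⟨fun h => absurd (Finset.mem_range.1 (hp.right h)) hy,
        fun h => absurd (Finset.mem_range.1 (hp'.right h)) hy⟩
  subst hH
  have := (enum_strictMono hp.right hp.pos).injective (he 0)
  exact ⟨rfl, rfl, by omega⟩

end hasData

/-! ### From a long 321-avoiding element to its data -/

theorem eq_shift_of_range_eq {f g : ℤ → ℤ} (hf : StrictMono f) (hg : StrictMono g)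
    (h : ∀ x, (∃ i, f i = x) ↔ ∃ i, g i = x) : ∃ c, ∀ i, f i = g (i + c) := by
  choose φ hφ using fun i => (h (f i)).1 ⟨i, rfl⟩
  have hmono : StrictMono φ := fun i j hij => hg.lt_iff_lt.1 (by rw [hφ, hφ]; exact hf hij)
  have hsurj : Function.Surjective φ := by
    intro j
    obtain ⟨i, hi⟩ := (h (g j)).2 ⟨j, rfl⟩
    exact ⟨i, hg.injective (by rw [hφ, hi])⟩
  exact ⟨φ 0, fun i => by rw [← strictMono_surjective_int hmono hsurj, hφ]⟩

/-- A strictly increasing function which commutes with translations is an enumeration, up to a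
shift of the index. -/
theorem exists_enum_shift (hn : 0 < n) {f : ℤ → ℤ} (hf : StrictMono f) {k : ℕ}
    (hfk : ∀ i q : ℤ, f (i + q * k) = f i + q * n) {H : Finset ℕ} (hH : H ⊆ Finset.range n)
    (hmem : ∀ y < n, y ∈ H ↔ ∃ i, f i = y + 1) : H.card = k ∧ ∃ c, ∀ i, f i = enum n H (i + c) := by
  have hres : ∀ y q : ℤ, (∃ i, f i = y + 1 + q * n) ↔ ∃ i, f i = y + 1 := by
    intro y q
    constructor
    · rintro ⟨i, hi⟩
      exact ⟨i + (-q) * k, by rw [hfk, hi]; ring⟩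
    · rintro ⟨i, hi⟩
      exact ⟨i + q * k, by rw [hfk, hi]⟩
  have h0 : 0 < H.card := by
    obtain ⟨y, hy, q, hx⟩ := exists_residue hn (f 0)
    exact Finset.card_pos.2 ⟨y, (hmem y hy).2 ((hres y q).1 ⟨0, hx⟩)⟩
  obtain ⟨c, hc⟩ := eq_shift_of_range_eq hf (enum_strictMono hH h0) (by
    intro x
    obtain ⟨y, hy, q, rfl⟩ := exists_residue hn x
    rw [exists_enum_iff hH h0 hy, hres, hmem y hy])
  refine ⟨?_, c, hc⟩
  have h1 := hfk 0 1
  rw [hc, hc, ← enum_add_mul h0] at h1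
  have := (enum_strictMono hH h0).injective h1
  omega

theorem exists_data_of_split (hn : 0 < n) {w : affineSymmetricGroup n} {A : Finset ℕ}
    (hA : A ⊆ Finset.range n) (h0 : 0 < A.card) (h1 : A.card < n)
    (hhigh : StrictMono fun i => w.1 (enum n A i))
    (hlow : StrictMono fun j => w.1 (enum n (Finset.range n \ A) j)) :
    ∃ H c, IsPair n A H ∧ HasData w A H c := by
  classical
  have hcA := card_compl hA
  have h0' : 0 < (Finset.range n \ A).card := by omega
  have hfA : ∀ i q : ℤ, w.1 (enum n A (i + q * A.card)) + A.card =
      w.1 (enum n A i) + A.card + q * n := by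
    intro i q
    rw [enum_add_mul h0, apply_add_mul]
    ring
  have hfB : ∀ i q : ℤ, w.1 (enum n (Finset.range n \ A) (i + q * (Finset.range n \ A).card)) +
      A.card = w.1 (enum n (Finset.range n \ A) i) + A.card + q * n := by
    intro i q
    rw [enum_add_mul h0', apply_add_mul]
    ring
  set H := (Finset.range n).filter fun y : ℕ => ∃ i, w.1 (enum n A i) + A.card = y + 1 with hHdef
  have hH : H ⊆ Finset.range n := Finset.filter_subset _ _
  obtain ⟨hcard, c, hc⟩ := exists_enum_shift hn (hhigh.add_const (A.card : ℤ)) hfA hH (by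
    intro y hy
    simp [hHdef, hy])
  obtain ⟨hcard', c', hc'⟩ := exists_enum_shift (H := Finset.range n \ H) hn
    (hlow.add_const (A.card : ℤ)) hfB Finset.sdiff_subset (by
    intro y hy
    simp only [hHdef, Finset.mem_sdiff, Finset.mem_range, hy, Finset.mem_filter, true_and]
    constructor
    · intro h
      obtain ⟨x, hx⟩ := w.1.surjective (y + 1 - A.card)
      rcases enum_or hA h0 h1 x with ⟨i, rfl⟩ | ⟨j, rfl⟩
      · exact absurd ⟨i, by rw [hx]; ring⟩ h
      · exact ⟨j, by rw [hx]; ring⟩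
    · rintro ⟨j, hj⟩ ⟨i, hi⟩
      exact enum_ne_compl hA h0 h1 i j (w.1.injective (by linarith)))
  have hp : IsPair n A H := ⟨hA, hH, hcard.symm, by omega, by omega⟩
  -- The normalization of the window sum ties the two shifts together.
  have hsum : c + c' = H.card := by
    have hs := w.2.2
    have hi : ∀ i, w.1 (enum n A i) = enum n H (i + c) - A.card := fun i => by
      have := hc i; linarith
    have hj : ∀ j, w.1 (enum n (Finset.range n \ A) j) = enum n (Finset.range n \ H) (j + c') -
      A.card := fun j => by have := hc' j; linarith
    have hcH := card_compl hH
    rw [sum_window_split hA, Finset.sum_congr rfl fun (i : ℕ) _ => hi i,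
      Finset.sum_congr rfl fun (j : ℕ) _ => hj j, Finset.sum_sub_distrib, Finset.sum_sub_distrib,
      ← hcard, ← hcard', sum_enum_shift hp.pos, sum_enum_shift hp.right_compl_pos,
      sum_window_eq_range, ← Finset.sum_sdiff hH] at hs
    simp only [Finset.sum_add_distrib, Finset.sum_const, Finset.card_range, nsmul_eq_mul, mul_one,
      hcH] at hs
    have hn' : (n : ℤ) ≠ 0 := by positivity
    apply mul_left_cancel₀ hn'
    linear_combination hs
  refine ⟨H, c, hp, fun i => ?_, fun j => ?_⟩
  · have := hc i
    rw [hcard]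
    linarith
  · have := hc' j
    rw [show (H.card : ℤ) - c = c' by linarith, hcard]
    linarith

theorem exists_data (hn : 0 < n) {w : affineSymmetricGroup n} (hw : Avoids321 w)
    (hlong : IsLong w) : ∃ A H c, IsPair n A H ∧ HasData w A H c ∧ (H.card : ℤ) < c := by
  obtain ⟨a, ha, b, hb, hab⟩ := (isLong_iff hn w).1 hlong
  obtain ⟨s, hs, hmax⟩ := Finset.exists_max_image (Finset.Icc (1 : ℤ) n) (fun j => w.1 j) ⟨a, ha⟩
  obtain ⟨t, ht, hmin⟩ := Finset.exists_min_image (Finset.Icc (1 : ℤ) n) (fun j => w.1 j) ⟨a, ha⟩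
  have hst : 2 * (n : ℤ) ≤ w.1 s - w.1 t := by
    have := hmax a ha
    have := hmin b hb
    linarith
  have hn' : (0 : ℤ) < n := by exact_mod_cast hn
  have hs' := Finset.mem_Icc.1 hs
  have ht' := Finset.mem_Icc.1 ht
  have hsn := apply_add_mul w s (-1)
  have htn := apply_add w t
  -- The threshold `w t + n` is the value at `t + n`, a position to the right of the window.
  set A := (Finset.range n).filter fun y : ℕ => w.1 t + n < w.1 (y + 1) with hAdef
  have hA : A ⊆ Finset.range n := Finset.filter_subset _ _
  have hsA : (s - 1).toNat ∈ A := by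
    rw [hAdef, Finset.mem_filter, Finset.mem_range, Int.toNat_of_nonneg (by omega), sub_add_cancel]
    exact ⟨by omega, by linarith⟩
  have htA : (t - 1).toNat ∈ Finset.range n \ A := by
    rw [Finset.mem_sdiff, hAdef, Finset.mem_filter, Finset.mem_range,
      Int.toNat_of_nonneg (by omega), sub_add_cancel]
    exact ⟨by omega, fun h => by linarith [h.2]⟩
  have hcA := card_compl hA
  have h0 : 0 < A.card := Finset.card_pos.2 ⟨_, hsA⟩
  have h0' : 0 < (Finset.range n \ A).card := Finset.card_pos.2 ⟨_, htA⟩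
  have hA_high : ∀ y ∈ A, w.1 t + n < w.1 (y + 1) ∧ w.1 s - n < w.1 (y + 1) := by
    intro y hy
    have h1 := (Finset.mem_filter.1 hy).2
    have h2 := Finset.mem_range.1 (hA hy)
    refine ⟨h1, ?_⟩
    by_contra hc
    have hne : w.1 (y + 1) ≠ w.1 (s + (-1) * n) := fun h => by
      have := w.1.injective h; linarith
    -- A value below `w s - n` would be the middle of a 321 between `s - n` and `t + n`. Hence the
    -- high window values lie within less than `n` of each other.
    exact hw (s + (-1) * n) (y + 1) (t + n) (by linarith) (by linarith)
      (lt_of_le_of_ne (by linarith) hne) (by linarith)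
  have hA_low : ∀ y ∈ Finset.range n \ A, w.1 (y + 1) < w.1 t + n := by
    intro y hy
    have h2 := Finset.mem_range.1 (Finset.mem_sdiff.1 hy).1
    have h1 : ¬ w.1 t + n < w.1 (y + 1) := fun h =>
      (Finset.mem_sdiff.1 hy).2 (Finset.mem_filter.2 ⟨(Finset.mem_sdiff.1 hy).1, h⟩)
    refine lt_of_le_of_ne (not_lt.1 h1) fun h => ?_
    rw [← htn] at h
    have := w.1.injective h
    linarith
  have hwin : ∀ y : ℕ, y < n → (y : ℤ) + 1 ∈ Finset.Icc (1 : ℤ) n := fun y hy => by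
    rw [Finset.mem_Icc]; omega
  -- an increasing enumeration of positions whose values in the window spread over less than `n`
  have mono : ∀ S ⊆ Finset.range n, 0 < S.card →
      (∀ y ∈ S, ∀ z ∈ S, w.1 (z + 1) < w.1 (y + 1) + n) →
      (∀ y ∈ S, ∀ z ∈ S, y < z → ¬ w.1 (z + 1) < w.1 (y + 1)) →
      StrictMono fun i => w.1 (enum n S i) := by
    intro S hS hS0 hspread horder i j hij
    obtain ⟨r, q, hr, rfl⟩ := exists_index hS0 i
    obtain ⟨r', q', hr', rfl⟩ := exists_index hS0 j
    simp only [enum_add_mul hS0, enum_natCast hr, enum_natCast hr', apply_add_mul]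
    have hm := nth_mem hr
    have hm' := nth_mem hr'
    have hqq : q ≤ q' := by
      by_contra hc
      have : (q' + 1) * (S.card : ℤ) ≤ q * S.card :=
        mul_le_mul_of_nonneg_right (by omega) (by positivity)
      have : (r' : ℤ) < S.card := by exact_mod_cast hr'
      linarith
    rcases hqq.lt_or_eq with hq | rfl
    · have := hspread _ hm' _ hm
      have : (q + 1) * (n : ℤ) ≤ q' * n := mul_le_mul_of_nonneg_right (by omega) hn'.le
      linarith
    · have hrr : r < r' := by omega
      have hlt := nth_lt hrr hr'
      have h1 := horder _ hm _ hm' hlt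
      have hne : w.1 ((Nat.nth (· ∈ S) r : ℤ) + 1) ≠ w.1 ((Nat.nth (· ∈ S) r' : ℤ) + 1) := fun h => by
        have := w.1.injective h
        omega
      have := lt_of_le_of_ne (not_lt.1 h1) hne
      linarith
  obtain ⟨H, c, hp, hd⟩ := exists_data_of_split hn hA h0 (by omega)
    (mono A hA h0
      (fun y hy z hz => by
        have := (hA_high y hy).2
        have := hmax _ (hwin z (Finset.mem_range.1 (hA hz)))
        linarith)
      (fun y hy z hz hyz h => by
        have h1 := (hA_high z hz).1
        have h2 := Finset.mem_range.1 (hA hz)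
        -- An inversion of high positions is completed by `t + n`.
        exact hw (y + 1) (z + 1) (t + n) (by omega) (by linarith) h (by linarith)))
    (mono _ Finset.sdiff_subset h0'
      (fun y hy z hz => by
        have := hA_low z hz
        have := hmin _ (hwin y (Finset.mem_range.1 (Finset.mem_sdiff.1 hy).1))
        linarith)
      (fun y hy z hz hyz h => by
        have h1 := hA_low y hy
        -- An inversion of low positions is completed by `s - n`, whose value is at least `w t + n`;
        -- here the difference `2n` is needed.
        exact hw (s + (-1) * n) (y + 1) (z + 1) (by linarith) (by omega) (by linarith) h))
  refine ⟨A, H, c, hp, hd, ?_⟩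
  -- If `c ≤ H.card`, then `w s ≤ 2n - H.card` and `w t > -H.card`, so these entries differ by less
  -- than `2n`.
  by_contra hc
  have hcard := hp.card_eq
  obtain ⟨i, hi, hi'⟩ := exists_nth_eq hsA
  obtain ⟨j, hj, hj'⟩ := exists_nth_eq htA
  have h1 := hd.high i
  have h2 := hd.low j
  rw [enum_natCast hi, hi', Int.toNat_of_nonneg (by omega), sub_add_cancel] at h1
  rw [enum_natCast hj, hj', Int.toNat_of_nonneg (by omega), sub_add_cancel] at h2
  have h3 := enum_le hp.right hp.pos (i := (i : ℤ) + c) (q := 2) (by omega)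
  have h4 := lt_enum (n := n) (S := Finset.range n \ H) Finset.sdiff_subset hp.right_compl_pos
    (i := (j : ℤ) + (H.card - c)) (q := 0) (by omega)
  linarith

end AffinePerm

/-! ### Subset sums and `q`-binomial coefficients -/

open PowerSeries in
theorem qPochhammer_succ (n : ℕ) : qPochhammer (n + 1) = qPochhammer n * (1 - X ^ (n + 1)) :=
  Finset.prod_range_succ _ _

open PowerSeries in
theorem constantCoeff_qPochhammer (n : ℕ) : constantCoeff (R := ℚ) (qPochhammer n) = 1 := by
  rw [qPochhammer, map_prod]
  exact Finset.prod_eq_one fun i _ => by simp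

open PowerSeries in
theorem sum_powersetCard_succ (n k : ℕ) :
    ∑ H ∈ (Finset.range (n + 1)).powersetCard (k + 1), (X : PowerSeries ℚ) ^ (∑ y ∈ H, y) =
      ∑ H ∈ (Finset.range n).powersetCard (k + 1), (X : PowerSeries ℚ) ^ (∑ y ∈ H, y) +
        X ^ n * ∑ H ∈ (Finset.range n).powersetCard k, (X : PowerSeries ℚ) ^ (∑ y ∈ H, y) := by
  have hmem : ∀ j, ∀ H ∈ (Finset.range n).powersetCard j, n ∉ H := fun j H hH h =>
    absurd (Finset.mem_range.1 ((Finset.mem_powersetCard.1 hH).1 h)) (lt_irrefl _)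
  rw [Finset.range_add_one, Finset.powersetCard_succ_insert (by simp), Finset.sum_union,
    Finset.sum_image, Finset.mul_sum]
  · congr 1
    refine Finset.sum_congr rfl fun H hH => ?_
    rw [Finset.sum_insert (hmem k H hH), pow_add]
  · intro H hH H' hH' h
    rw [← Finset.erase_insert (hmem k H hH), ← Finset.erase_insert (hmem k H' hH')]
    exact congrArg (fun S => Finset.erase S n) h
  · rw [Finset.disjoint_left]
    intro H hH hH'
    obtain ⟨H', -, rfl⟩ := Finset.mem_image.1 hH'
    exact hmem _ _ hH (Finset.mem_insert_self _ _)

open PowerSeries in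
-- Gauss's formula with denominators cleared; the induction is the `q`-Pascal rule, which splits the
-- subsets by whether they contain the largest element.
theorem sum_powersetCard_mul_qPochhammer (n : ℕ) : ∀ k ≤ n,
    (∑ H ∈ (Finset.range n).powersetCard k, (X : PowerSeries ℚ) ^ (∑ y ∈ H, y)) *
      (qPochhammer k * qPochhammer (n - k)) = X ^ k.choose 2 * qPochhammer n := by
  induction n with
  | zero =>
    intro k hk
    obtain rfl : k = 0 := by omega
    simp [qPochhammer]
  | succ n ih =>
    intro k hk
    rcases k with - | k
    · simp [qPochhammer]
    have ih1 := ih k (by omega)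
    rw [sum_powersetCard_succ, Nat.choose_succ_succ, Nat.choose_one_right, pow_add,
      show n + 1 - (k + 1) = n - k by omega, qPochhammer_succ k, qPochhammer_succ n]
    by_cases hkn : k + 1 ≤ n
    · have ih2 := ih (k + 1) hkn
      rw [Nat.choose_succ_succ, Nat.choose_one_right, pow_add, qPochhammer_succ k] at ih2
      obtain ⟨d, rfl⟩ := Nat.exists_eq_add_of_le hkn
      rw [show k + 1 + d - (k + 1) = d by omega] at ih2
      rw [show k + 1 + d - k = d + 1 by omega] at ih1 ⊢
      rw [qPochhammer_succ d] at ih1 ⊢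
      generalize qPochhammer k = P at *
      generalize qPochhammer d = Q at *
      generalize qPochhammer (k + 1 + d) = R at *
      generalize (X : PowerSeries ℚ) ^ k.choose 2 = Y at *
      rw [add_mul]
      -- This uses `1 - X^(k+d+2) = (1 - X^(d+1)) + X^(d+1) (1 - X^(k+1))`.
      linear_combination (1 - X ^ (d + 1)) * ih2 + X ^ (k + 1 + d) * (1 - X ^ (k + 1)) * ih1
    · obtain rfl : k = n := by omega
      rw [Finset.powersetCard_eq_empty.2 (by simp)]
      rw [Finset.sum_empty, zero_add]
      linear_combination X ^ k * (1 - X ^ (k + 1)) * ih1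

open PowerSeries in
theorem sum_powersetCard (n k : ℕ) (hk : k ≤ n) :
    ∑ H ∈ (Finset.range n).powersetCard k, (X : PowerSeries ℚ) ^ (∑ y ∈ H, y) =
      X ^ k.choose 2 * qBinomial n k := by
  have h : constantCoeff (R := ℚ) (qPochhammer k * qPochhammer (n - k)) ≠ 0 := by
    simp [constantCoeff_qPochhammer]
  rw [qBinomial, ← mul_assoc, PowerSeries.eq_mul_inv_iff_mul_eq h]
  exact sum_powersetCard_mul_qPochhammer n k hk

theorem qBinomial_symm {n k : ℕ} (hk : k ≤ n) : qBinomial n (n - k) = qBinomial n k := by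
  rw [qBinomial, qBinomial, Nat.sub_sub_self hk, mul_comm (qPochhammer k)]

open PowerSeries Classical in
theorem X_pow_mul_inv {n : ℕ} (hn : 0 < n) :
    (X : PowerSeries ℚ) ^ n * (1 - X ^ n)⁻¹ =
      PowerSeries.mk fun m => if ∃ t, n * (t + 1) = m then (1 : ℚ) else 0 := by
  have h : constantCoeff (R := ℚ) (1 - X ^ n) ≠ 0 := by simp [hn.ne']
  symm
  rw [PowerSeries.eq_mul_inv_iff_mul_eq h]
  ext m
  rw [mul_sub, mul_one, map_sub, coeff_mk, coeff_mul_X_pow', coeff_X_pow, coeff_mk]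
  rcases lt_or_ge m n with hm | hm
  · have h1 : ¬ ∃ t, n * (t + 1) = m := by
      rintro ⟨t, rfl⟩
      nlinarith
    rw [if_neg h1, if_neg hm.not_ge, if_neg hm.ne, sub_zero]
  · obtain ⟨d, rfl⟩ := Nat.exists_eq_add_of_le hm
    rw [if_pos hm, Nat.add_sub_cancel_left]
    rcases Nat.eq_zero_or_pos d with rfl | hd
    · have h1 : ¬ ∃ t, n * (t + 1) = 0 := by
        rintro ⟨t, ht⟩
        nlinarith
      rw [if_pos ⟨0, by ring⟩, if_neg h1, if_pos (by ring), sub_zero]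
    · have h1 : (∃ t, n * (t + 1) = n + d) ↔ ∃ t, n * (t + 1) = d := by
        constructor
        · rintro ⟨t, ht⟩
          rcases t with - | t
          · omega
          · exact ⟨t, by linarith⟩
        · rintro ⟨t, rfl⟩
          exact ⟨t + 1, by ring⟩
      simp only [h1, sub_self]
      rw [if_neg (by omega)]

/-! ### Counting by length and comparing coefficients -/

namespace AffinePerm

variable {n : ℕ}

/-- Passing to the complement of `A` gives both sums a positive sign; the binomials are the least
sums that subsets of these sizes can have. -/
theorem HasData.coxeterLength_eq_iff (hn : 2 ≤ n) {w : affineSymmetricGroup n} {A H : Finset ℕ}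
    {c : ℤ} (hp : IsPair n A H) (h : HasData w A H c) (hc : (H.card : ℤ) < c) (m : ℕ) :
    coxeterLength w = m ↔ n * (c - H.card) + (∑ y ∈ H, (y : ℤ) + ∑ y ∈ Finset.range n \ A, (y : ℤ)) =
      m + H.card.choose 2 + (n - H.card).choose 2 := by
  have h1 := coxeterLength_eq hn w
  rw [h.inversionNumber_eq hn hp hc] at h1
  have h2 := Finset.sum_sdiff (f := fun y : ℕ => (y : ℤ)) hp.left
  have h3 : ∀ k : ℕ, ((k.choose 2 : ℕ) : ℤ) * 2 = k * (k - 1) := by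
    intro k
    have := Nat.cast_choose_two ℚ k
    have h : ((k.choose 2 : ℕ) : ℚ) * 2 = k * (k - 1) := by rw [this]; ring
    exact_mod_cast h
  have h4 : (∑ y ∈ Finset.range n, (y : ℤ)) * 2 = n * (n - 1) := by
    have := Finset.sum_range_id_mul_two n
    have h : ((∑ y ∈ Finset.range n, y : ℕ) : ℤ) * 2 = n * ((n - 1 : ℕ) : ℤ) := by
      exact_mod_cast this
    rwa [Nat.cast_sum, Nat.cast_sub (by omega), Nat.cast_one] at h
  have h5 := h3 H.card
  have h6 := h3 (n - H.card)
  rw [Nat.cast_sub hp.lt.le] at h6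
  rw [← h2] at h4
  have h7 : (coxeterLength w : ℤ) + H.card.choose 2 + (n - H.card).choose 2 =
      n * (c - H.card) + (∑ y ∈ H, (y : ℤ) + ∑ y ∈ Finset.range n \ A, (y : ℤ)) := by
    apply mul_right_cancel₀ (two_ne_zero (α := ℤ))
    linear_combination 2 * h1 + h5 + h6 - h4
  rw [← h7]
  constructor
  · rintro rfl
    rfl
  · intro h
    have : (coxeterLength w : ℤ) = m := by linarith
    exact_mod_cast this

open Classical in
/-- The pairs of sets which belong to long fully commutative elements of length `m`. -/
noncomputable def pairs (n m : ℕ) : Finset (Finset ℕ × Finset ℕ) :=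
  ((Finset.range n).powerset ×ˢ (Finset.range n).powerset).filter fun P =>
    (P.1.card = P.2.card ∧ 0 < P.2.card ∧ P.2.card < n) ∧
      ∃ t : ℕ, n * (t + 1) + (∑ y ∈ P.2, y + ∑ y ∈ Finset.range n \ P.1, y) =
        m + P.2.card.choose 2 + (n - P.2.card).choose 2

theorem mem_pairs {m : ℕ} {P : Finset ℕ × Finset ℕ} :
    P ∈ pairs n m ↔ IsPair n P.1 P.2 ∧
      ∃ t : ℕ, n * (t + 1) + (∑ y ∈ P.2, y + ∑ y ∈ Finset.range n \ P.1, y) =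
        m + P.2.card.choose 2 + (n - P.2.card).choose 2 := by
  classical
  rw [pairs, Finset.mem_filter, Finset.mem_product, Finset.mem_powerset, Finset.mem_powerset]
  constructor
  · rintro ⟨⟨h1, h2⟩, ⟨h3, h4, h5⟩, h6⟩
    exact ⟨⟨h1, h2, h3, h4, h5⟩, h6⟩
  · rintro ⟨⟨h1, h2, h3, h4, h5⟩, h6⟩
    exact ⟨⟨h1, h2⟩, ⟨h3, h4, h5⟩, h6⟩

theorem exists_of_mem_pairs (hn : 2 ≤ n) {m : ℕ} {P : Finset ℕ × Finset ℕ} (hP : P ∈ pairs n m) :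
    ∃ w ∈ longFullyCommutative n m, ∃ c, HasData w P.1 P.2 c ∧ (P.2.card : ℤ) < c := by
  obtain ⟨hp, t, ht⟩ := mem_pairs.1 hP
  obtain ⟨w, hw⟩ := exists_hasData hp (P.2.card + (t + 1))
  have hc : (P.2.card : ℤ) < P.2.card + (t + 1) := by omega
  refine ⟨w, ⟨(isFullyCommutative_iff hn w).2 (hw.avoids hp), hw.isLong hp hc, ?_⟩, _, hw, hc⟩
  rw [hw.coxeterLength_eq_iff hn hp hc, add_sub_cancel_left]
  have := congrArg (Nat.cast : ℕ → ℤ) ht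
  push_cast at this
  exact this

theorem exists_mem_pairs (hn : 2 ≤ n) {m : ℕ} {w : affineSymmetricGroup n}
    (hw : w ∈ longFullyCommutative n m) :
    ∃ P ∈ pairs n m, ∃ c, HasData w P.1 P.2 c ∧ (P.2.card : ℤ) < c := by
  obtain ⟨h1, h2, h3⟩ := hw
  obtain ⟨A, H, c, hp, h, hc⟩ := exists_data (by omega) ((isFullyCommutative_iff hn w).1 h1) h2
  refine ⟨(A, H), mem_pairs.2 ⟨hp, (c - H.card - 1).toNat, ?_⟩, c, h, hc⟩
  have := (h.coxeterLength_eq_iff hn hp hc m).1 h3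
  have e : (((c - H.card - 1).toNat : ℕ) : ℤ) + 1 = c - H.card := by omega
  rw [← e] at this
  apply Nat.cast_injective (R := ℤ)
  push_cast
  exact this

/-- The shift `c` is not recorded in the pair, since the length `m` and the pair determine it. -/
theorem exists_bijOn (hn : 2 ≤ n) (m : ℕ) :
    ∃ g : Finset ℕ × Finset ℕ → affineSymmetricGroup n,
      Set.BijOn g (pairs n m) (longFullyCommutative n m) := by
  have h : ∀ P, ∃ w : affineSymmetricGroup n, P ∈ pairs n m →
      w ∈ longFullyCommutative n m ∧ ∃ c, HasData w P.1 P.2 c ∧ (P.2.card : ℤ) < c := by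
    intro P
    by_cases hP : P ∈ pairs n m
    · obtain ⟨w, h⟩ := exists_of_mem_pairs hn hP
      exact ⟨w, fun _ => h⟩
    · exact ⟨1, fun h => absurd h hP⟩
  choose g hg using h
  refine ⟨g, fun P hP => (hg P hP).1, ?_, ?_⟩
  · intro P hP Q hQ hPQ
    obtain ⟨-, c, h1, h2⟩ := hg P hP
    obtain ⟨-, c', h1', h2'⟩ := hg Q hQ
    rw [← hPQ] at h1'
    obtain ⟨e1, e2, -⟩ := h1.data_unique (mem_pairs.1 hP).1 h2 (mem_pairs.1 hQ).1 h1' h2'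
    exact Prod.ext e1 e2
  · intro w hw
    obtain ⟨P, hP, c, h1, h2⟩ := exists_mem_pairs hn hw
    refine ⟨P, hP, ?_⟩
    obtain ⟨hl, c', h1', h2'⟩ := hg P hP
    have hp := (mem_pairs.1 hP).1
    have e1 := (h1.coxeterLength_eq_iff hn hp h2 m).1 hw.2.2
    have e2 := (h1'.coxeterLength_eq_iff hn hp h2' m).1 hl.2.2
    have hn' : (n : ℤ) ≠ 0 := by positivity
    have hc : c' = c := by
      have : (n : ℤ) * c' = n * c := by linarith
      exact mul_left_cancel₀ hn' this
    subst hc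
    exact h1'.unique hp h1

open Classical in
theorem card_pairs (n m : ℕ) : ((pairs n m).card : ℚ) = ∑ k ∈ Finset.Icc 1 (n - 1),
    ∑ A ∈ (Finset.range n).powersetCard k, ∑ H ∈ (Finset.range n).powersetCard k,
      if ∃ t : ℕ, n * (t + 1) + (∑ y ∈ H, y + ∑ y ∈ Finset.range n \ A, y) =
        m + k.choose 2 + (n - k).choose 2 then (1 : ℚ) else 0 := by
  rw [Finset.card_eq_sum_card_fiberwise (f := fun P => P.2.card) (t := Finset.Icc 1 (n - 1))]
  · rw [Nat.cast_sum]
    refine Finset.sum_congr rfl fun k hk => ?_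
    rw [Finset.mem_Icc] at hk
    rw [← Finset.sum_product', ← Finset.sum_filter, Finset.sum_const, nsmul_eq_mul, mul_one]
    congr 2
    ext P
    simp only [Finset.mem_filter, pairs, Finset.mem_product, Finset.mem_powerset,
      Finset.mem_powersetCard]
    constructor
    · rintro ⟨⟨⟨h1, h2⟩, ⟨h3, h4, h5⟩, h6⟩, rfl⟩
      exact ⟨⟨⟨h1, h3⟩, h2, rfl⟩, h6⟩
    · rintro ⟨⟨⟨h1, h3⟩, h2, rfl⟩, h6⟩
      exact ⟨⟨⟨h1, h2⟩, ⟨h3, by omega, by omega⟩, h6⟩, rfl⟩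
  · intro P hP
    have := (mem_pairs.1 (Finset.mem_coe.1 hP)).1
    have h1 := this.pos
    have h2 := this.lt
    exact Finset.mem_coe.2 (Finset.mem_Icc.2 ⟨h1, Nat.le_sub_one_of_lt h2⟩)

theorem sum_powersetCard_compl {M : Type*} [AddCommMonoid M] {n k : ℕ} (hk : k ≤ n)
    (f : Finset ℕ → M) :
    ∑ A ∈ (Finset.range n).powersetCard k, f (Finset.range n \ A) =
      ∑ T ∈ (Finset.range n).powersetCard (n - k), f T := by
  have hc : ∀ {j}, ∀ A ∈ (Finset.range n).powersetCard j,
      Finset.range n \ A ∈ (Finset.range n).powersetCard (n - j) := by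
    intro j A hA
    rw [Finset.mem_powersetCard] at hA ⊢
    refine ⟨Finset.sdiff_subset, ?_⟩
    rw [Finset.card_sdiff_of_subset hA.1, Finset.card_range, hA.2]
  refine Finset.sum_bij' (fun A _ => Finset.range n \ A) (fun T _ => Finset.range n \ T) ?_ ?_ ?_ ?_ ?_
  · exact fun A hA => hc A hA
  · intro T hT
    have := hc T hT
    rwa [Nat.sub_sub_self hk] at this
  · exact fun A hA => Finset.sdiff_sdiff_eq_self (Finset.mem_powersetCard.1 hA).1
  · exact fun T hT => Finset.sdiff_sdiff_eq_self (Finset.mem_powersetCard.1 hT).1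
  · intros; rfl

open PowerSeries Classical in
-- Raising the degree by both binomials turns the two `q`-binomials into subset sums, one for `H`
-- and, by symmetry in `k`, one for the complement of `A`.
theorem coeff_qBinomial_sq (hn : 0 < n) {k : ℕ} (hk : k ≤ n) (m : ℕ) :
    coeff m (X ^ n * (1 - X ^ n)⁻¹ * qBinomial n k ^ 2) =
      ∑ A ∈ (Finset.range n).powersetCard k, ∑ H ∈ (Finset.range n).powersetCard k,
        if ∃ t : ℕ, n * (t + 1) + (∑ y ∈ H, y + ∑ y ∈ Finset.range n \ A, y) =
          m + k.choose 2 + (n - k).choose 2 then (1 : ℚ) else 0 := by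
  rw [sum_powersetCard_compl hk fun T => ∑ H ∈ (Finset.range n).powersetCard k,
    if ∃ t : ℕ, n * (t + 1) + (∑ y ∈ H, y + ∑ y ∈ T, y) =
      m + k.choose 2 + (n - k).choose 2 then (1 : ℚ) else 0]
  have h1 := sum_powersetCard n k hk
  have h2 := sum_powersetCard n (n - k) (Nat.sub_le _ _)
  rw [qBinomial_symm hk] at h2
  rw [← coeff_mul_X_pow _ (k.choose 2 + (n - k).choose 2), ← add_assoc,
    show X ^ n * (1 - X ^ n)⁻¹ * qBinomial n k ^ 2 * X ^ (k.choose 2 + (n - k).choose 2) =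
      (X ^ (n - k).choose 2 * qBinomial n k) * (X ^ k.choose 2 * qBinomial n k) *
        (X ^ n * (1 - X ^ n)⁻¹) by rw [pow_add]; ring,
    ← h1, ← h2, X_pow_mul_inv hn, Finset.sum_mul_sum, Finset.sum_mul, map_sum]
  refine Finset.sum_congr rfl fun T _ => ?_
  rw [Finset.sum_mul, map_sum]
  refine Finset.sum_congr rfl fun H _ => ?_
  rw [← pow_add, mul_comm, coeff_mul_X_pow', coeff_mk, add_comm (∑ y ∈ T, y)]
  split_ifs with h3 h4 h5 h5 h5
  · rfl
  · obtain ⟨t, ht⟩ := h4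
    exact absurd ⟨t, by omega⟩ h5
  · obtain ⟨t, ht⟩ := h5
    exact absurd ⟨t, by omega⟩ h4
  · rfl
  · obtain ⟨t, ht⟩ := h5
    omega
  · rfl

/-- For `n = 0` the abacus is empty and has no last bead; for `n = 1` the window has a single entry.
-/
theorem longFullyCommutative_eq_empty (hn : ¬ 2 ≤ n) (m : ℕ) : longFullyCommutative n m = ∅ := by
  rw [Set.eq_empty_iff_forall_notMem]
  rintro w ⟨-, hw, -⟩
  rcases Nat.eq_zero_or_pos n with rfl | hn0
  · obtain ⟨A, i, ⟨⟨d, rfl⟩, -⟩, hi, -⟩ := hw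
    obtain ⟨_, ⟨j, hj, -⟩, -⟩ := hi.1
    simp at hj
  · obtain ⟨i, hi, j, hj, h⟩ := (isLong_iff hn0 w).1 hw
    obtain rfl : n = 1 := by omega
    rw [Finset.mem_Icc] at hi hj
    obtain rfl : i = j := by omega
    omega

end AffinePerm

theorem lemma3p3 (n : ℕ) :
    (∀ m : ℕ, (longFullyCommutative n m).Finite) ∧
    PowerSeries.mk (fun m : ℕ => ((longFullyCommutative n m).ncard : ℚ)) =
      (PowerSeries.X ^ n * (1 - PowerSeries.X ^ n)⁻¹) *
        ∑ k ∈ Finset.Icc 1 (n - 1), qBinomial n k ^ 2 := by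
  by_cases hn : 2 ≤ n
  · refine ⟨fun m => ?_, ?_⟩
    · obtain ⟨g, hg⟩ := AffinePerm.exists_bijOn hn m
      rw [← hg.image_eq]
      exact (Finset.finite_toSet _).image g
    · ext m
      obtain ⟨g, hg⟩ := AffinePerm.exists_bijOn hn m
      rw [PowerSeries.coeff_mk, ← hg.image_eq, hg.injOn.ncard_image,
        Set.ncard_coe_finset, AffinePerm.card_pairs, Finset.mul_sum, map_sum]
      refine Finset.sum_congr rfl fun k hk => ?_
      rw [Finset.mem_Icc] at hk
      rw [AffinePerm.coeff_qBinomial_sq (by omega) (by omega)]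
  · have h := AffinePerm.longFullyCommutative_eq_empty hn
    refine ⟨fun m => by rw [h]; exact Set.finite_empty, ?_⟩
    -- Truncated subtraction makes the interval empty for `n = 0` as well; the factor `(1 - X ^
    -- 0)⁻¹`, an inverse of `0`, thus plays no role.
    rw [Finset.Icc_eq_empty (by omega), Finset.sum_empty, mul_zero]
    ext m
    rw [PowerSeries.coeff_mk, h, Set.ncard_empty]
    simp
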